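/- **Four closure theorem.** Let $M$ be an $n$-dimensional smooth Riemannian manifold (without boundary, Hausdorff, second countable), with Riemannian volume $dM$ and Riemannian distance, and let $D\subset M$ be a quasi-Lipschitz domain (defined below). Let $W^{1,2}(D)$ be the space of all $u\in L^2(D)$ having a weak differential $du\in L^2(D)$, with $\|u\|_{W^{1,2}(D)}^2=\int_D (|u|^2+|du|^2)\,dM$. Put $$\mathcal F_{cpt}(D)=\{u\in C^\infty(D)\mid \overline{\operatorname{supp}u}\subset D\},\qquad \mathcal F(D)=\{u\in C^\infty(D)\cap C^1(\overline D)\mid u|_{\partial D}=0\},$$ $$\mathcal F_0(D)=\{u\in C^\infty(D)\cap C^0(\overline D)\mid u|_{\partial D}=0\},\qquad \mathcal F_{L^2}(D)=\{u\in C^\infty(D)\cap C^0(\overline D)\mid \|u|_{\partial D}\|_{L^2(\partial D)}=0\},$$ where $\overline{\operatorname{supp}u}$ is the closure in $M$, $L^2(\partial D)$ refers to the $(n-1)$-dimensional Hausdorff measure on $\partial D$, and $u\in C^1(\overline D)$ means that $u$ and $du$ extend continuously to $\overline D$. Let $H(D)$ be the closure of $\mathcal F_{L^2}(D)\cap W^{1,2}(D)$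 in $W^{1,2}(D)$, and let $W^{1,2}_0(D)$, the space of functions with zero trace on $\partial D$, be the closure of $\mathcal F_{cpt}(D)$ in $W^{1,2}(D)$. Then $$H(D)=W^{1,2}_0(D),$$ and the closures in $W^{1,2}(D)$ of the four sets $\mathcal F_{cpt}(D)$, $\mathcal F(D)$, $\mathcal F_0(D)\cap W^{1,2}(D)$ and $\mathcal F_{L^2}(D)\cap W^{1,2}(D)$ are all equal to $H(D)$. **Definitions.** A *domain* is a nonempty connected open set. *Lipschitz boundary.* $\partial D$ is Lipschitz at $p\in\partial D$ if there is a chart $\psi:W\to\mathbb R^n$ around $p$ such that, after singling out one coordinate $r$ and writing points of $\mathbb R^n$ as $(x,r)$, $x\in\mathbb R^{n-1}$, one has $\psi(D\cap W)=\{(x,r)\mid x\in V,\ u(x)<r<v(x)\}$ and $\psi(\partial D\cap W)=\{(x,u(x))\mid x\in V\}$, where $u<v$ on $V$, $u$ is Lipschitz, and $V\subset\mathbb R^{n-1}$ and $\psi(D\cap W)$ are open sets diffeomorphic to balls. *Cones.* For $A\subset\mathbb R^m$, $B\subset\mathbb R^\ell$ with $0\notin A\times B$ and $(x,y)\mapsto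 (x,y)/\sqrt{|x|^2+|y|^2}$ injective on $A\times B$, put $C_0(A\times B)=\{t(x,y)\mid t\ge0,\ x\in A,\ y\in B\}$. A set $G\subset M$ with $p\in G$ is *diffeomorphic under $\lambda$ into $C_0(A\times B)$ relative to $p$* if $\lambda(p)=0$, $\lambda$ is a homeomorphism of $G$ onto a neighbourhood of $0$ in $C_0(A\times B)$, $\lambda$ restricts to a diffeomorphism of $G\setminus\{p\}$ onto $\lambda(G)\setminus\{0\}$, and for all $x\in A$, $y\in B$ the curve $t\mapsto\lambda^{-1}(t(x,y))$, $t\ge 0$, has a nonzero one-sided derivative at $t=0$. *Quasi-Lipschitz domain.* A domain $D\subset M$ is quasi-Lipschitz if there are a smooth $n$-manifold $N$, a relatively compact domain $\Omega\subset N$ with smooth boundary, and a map $\varphi$ into $M$, defined and smooth on a neighbourhood of $\overline\Omega$, which restricts to a diffeomorphism $\Omega\to D$ and satisfies $\varphi(\partial\Omega)=\partial D$, together with a finite (possibly empty) set $P\subset\partial D$ of *glued points*, such that: 1. for each $p\in P$ the set $\alpha:=\partial\Omega\cap\varphi^{-1}(p)$ is either finite (then put $k=0$) or a compact connected smooth submanifold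 without boundary of some dimension $k$, $0<k<n-1$; 2. $\varphi$ maps $\partial\Omega\setminus\varphi^{-1}(P)$ homeomorphically onto $\partial D\setminus P$, and $\partial D$ is Lipschitz at each point of $\partial D\setminus P$; 3. if $k\neq0$, the pulled back metric $\varphi^*g$, where $g$ is the metric of $M$, is degenerate at each point of $\alpha$; 4. for each $p\in P$, after replacing $\alpha$ by a diffeomorphic copy in some $\mathbb R^m$, there are an open neighbourhood $U$ of $p$ in $M$ and a map $\lambda$ such that $(U\cap D)\cup\{p\}$ and $U\cap\partial D$ are diffeomorphic under (the restrictions of) $\lambda$ into $C_0(\alpha\times B^{n-1-k})$ and $C_0(\alpha\times S^{n-2-k})$, respectively, relative to $p$, where $B^{n-1-k}\subset\mathbb R^{n-1-k}$ is the open unit ball and $S^{n-2-k}$ the unit sphere bounding it; and for all $x\in\alpha$ and $y\ne y'$ in $S^{n-2-k}$ the unit tangent vectors at $p$ of the curves $t\mapsto\lambda^{-1}(t(x,y))$ and $t\mapsto\lambda^{-1}(t(x,y'))$ in $\partial D$ are different. -/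

import Mathlib

open Set Filter MeasureTheory Bundle Metric
open scoped Manifold ContDiff Topology ENNReal MeasureTheory

universe u v

noncomputable section

namespace QuasiLipschitz

/-! ### Diffeomorphisms between subsets, submanifolds, smooth boundaries -/

section Diffeo

variable {E : Type*} [NormedAddCommGroup E] [NormedSpace ℝ E]
  {H : Type*} [TopologicalSpace H] (I : ModelWithCorners ℝ E H)
  {X : Type*} [TopologicalSpace X] [ChartedSpace H X]
  {E' : Type*} [NormedAddCommGroup E'] [NormedSpace ℝ E']
  {H' : Type*} [TopologicalSpace H'] (J : ModelWithCorners ℝ E' H')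
  {Y : Type*} [TopologicalSpace Y] [ChartedSpace H' Y]

/-- `f` restricts to a `C^∞` diffeomorphism of the subset `s` onto the subset `t`, with
inverse `g`. -/
structure IsDiffeoOn (f : X → Y) (g : Y → X) (s : Set X) (t : Set Y) : Prop where
  smooth : ContMDiffOn I J ∞ f s
  image_eq : f '' s = t
  smooth_inv : ContMDiffOn J I ∞ g t
  leftInv : LeftInvOn g f s

end Diffeo

section Charts

variable {n : ℕ} {N : Type*} [TopologicalSpace N] [ChartedSpace (EuclideanSpace ℝ (Fin n)) N]

/-- `a` is an embedded `k`-dimensional `C^∞` submanifold (without boundary) of the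
`n`-dimensional manifold `N`: around each of its points there is a chart of `N` in which `a` is
the coordinate plane on which all coordinates but `k` vanish. -/
def IsSmoothSubmanifold (k : ℕ) (a : Set N) : Prop :=
  ∀ q ∈ a, ∃ e ∈ IsManifold.maximalAtlas (𝓡 n) ∞ N, q ∈ e.source ∧
    ∃ S : Finset (Fin n), S.card = k ∧
      ∀ x ∈ e.source, (x ∈ a ↔ ∀ j, j ∉ S → e x j = 0)

/-- The open set `Ω` has `C^∞` boundary: around each boundary point there is a chart in which
`Ω` is an open half space. -/
def HasSmoothBoundary (Ω : Set N) : Prop :=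
  ∀ q ∈ frontier Ω, ∃ e ∈ IsManifold.maximalAtlas (𝓡 n) ∞ N, q ∈ e.source ∧
    ∃ i : Fin n, ∀ x ∈ e.source, (x ∈ Ω ↔ 0 < e x i)

end Charts

/-! ### Lipschitz boundaries -/

/-- A simple domain: an open set diffeomorphic to the unit ball. -/
def IsSimpleDomain {F : Type*} [NormedAddCommGroup F] [NormedSpace ℝ F] (U : Set F) : Prop :=
  IsOpen U ∧ ∃ f g : F → F, IsDiffeoOn 𝓘(ℝ, F) 𝓘(ℝ, F) f g U (ball 0 1)

/-- The coordinates of `y ∈ ℝⁿ` other than the `i`-th one, i.e. the projection of `y` to the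
hyperplane `{yⁱ = 0}`, which is identified with `ℝⁿ⁻¹`. -/
def dropCoord {n : ℕ} (i : Fin n) (y : EuclideanSpace ℝ (Fin n)) :
    EuclideanSpace ℝ {j : Fin n // j ≠ i} :=
  WithLp.toLp 2 (fun j => y j)

/-- `(U, Γ, V)` is a Lipschitz triple in `ℝⁿ`, where the `i`-th coordinate is the vertical one:
`U = {(x, r) | x ∈ V, u x < r < v x}` and `Γ = {(x, u x) | x ∈ V}` with `u` Lipschitz on `V`,
where `U` and `V` are simple domains. -/
def IsLipschitzTriple {n : ℕ} (i : Fin n) (U Γ : Set (EuclideanSpace ℝ (Fin n)))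
    (V : Set (EuclideanSpace ℝ {j : Fin n // j ≠ i})) : Prop :=
  IsSimpleDomain U ∧ IsSimpleDomain V ∧
    ∃ (u v : EuclideanSpace ℝ {j : Fin n // j ≠ i} → ℝ) (L : NNReal),
      LipschitzOnWith L u V ∧ (∀ x ∈ V, u x < v x) ∧
      U = {y | dropCoord i y ∈ V ∧ u (dropCoord i y) < y i ∧ y i < v (dropCoord i y)} ∧
      Γ = {y | dropCoord i y ∈ V ∧ y i = u (dropCoord i y)}

section Lipschitz

variable {n : ℕ} {M : Type*} [TopologicalSpace M] [ChartedSpace (EuclideanSpace ℝ (Fin n)) M]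

variable (n) in
/-- The boundary of `D` is Lipschitz at `p`: there is a chart with domain `W ∋ p` which maps
`(D ∩ W, ∂D ∩ W)` to the first two entries of a Lipschitz triple. -/
def IsLipschitzBoundaryAt (D : Set M) (p : M) : Prop :=
  ∃ e ∈ IsManifold.maximalAtlas (𝓡 n) ∞ M, p ∈ e.source ∧
    ∃ (i : Fin n) (V : Set (EuclideanSpace ℝ {j : Fin n // j ≠ i})),
      IsLipschitzTriple i (e '' (D ∩ e.source)) (e '' (frontier D ∩ e.source)) V

end Lipschitz

/-! ### Cones and sector domains -/

section Cone

variable {F G : Type*} [NormedAddCommGroup F] [NormedSpace ℝ F]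
  [NormedAddCommGroup G] [NormedSpace ℝ G]

/-- The cone with vertex `0` and base `A × B`. -/
def cone (A : Set F) (B : Set G) : Set (F × G) :=
  {z | ∃ t : ℝ, 0 ≤ t ∧ ∃ x ∈ A, ∃ y ∈ B, z = (t • x, t • y)}

/-- The normalization `(x, y) ↦ (x, y) / √(|x|² + |y|²)` (with the Euclidean norm of the
product). -/
def normalize (z : F × G) : F × G :=
  (Real.sqrt (‖z.1‖ ^ 2 + ‖z.2‖ ^ 2))⁻¹ • z

/-- `A × B` is the base of a cone: it does not contain the origin, and each ray issuing from the
origin meets it at most once. -/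
def IsConeBase (A : Set F) (B : Set G) : Prop :=
  (0 : F × G) ∉ A ×ˢ B ∧ InjOn normalize (A ×ˢ B)

variable {n : ℕ} {M : Type*} [TopologicalSpace M] [ChartedSpace (EuclideanSpace ℝ (Fin n)) M]

/-- The curve `t ↦ linv (t • z)`, `t ≥ 0`, has at `t = 0` the one-sided derivative `w`, a
tangent vector at `p` (tangent vectors at `p` are by definition given by their coordinates in the
preferred chart at `p`). Used when `linv 0 = p`. -/
def HasRayTangent (p : M) (linv : F × G → M) (z : F × G) (w : TangentSpace (𝓡 n) p) : Prop :=
  HasDerivWithinAt (fun t : ℝ => extChartAt (𝓡 n) p (linv (t • z)))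
    (w : EuclideanSpace ℝ (Fin n)) (Ici 0) 0

variable (n) in
/-- The set `S ∋ p` is diffeomorphic under `lam` (with inverse `linv`) into the cone with base
`A × B`, relative to `p`. -/
structure IsDiffeoIntoCone (p : M) (S : Set M) (lam : M → F × G) (linv : F × G → M)
    (A : Set F) (B : Set G) : Prop where
  mem : p ∈ S
  map_vertex : lam p = 0
  continuousOn : ContinuousOn lam S
  continuousOn_inv : ContinuousOn linv (lam '' S)
  leftInv : LeftInvOn linv lam S
  image_subset : lam '' S ⊆ cone A B
  image_mem_nhds : lam '' S ∈ 𝓝[cone A B] 0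
  diffeo : IsDiffeoOn (𝓡 n) 𝓘(ℝ, F × G) lam linv (S \ {p}) (lam '' S \ {0})
  rays : ∀ x ∈ A, ∀ y ∈ B, ∃ w : TangentSpace (𝓡 n) p, w ≠ 0 ∧ HasRayTangent p linv (x, y) w

end Cone

section Gluing

variable {n : ℕ} {M : Type*} [TopologicalSpace M] [ChartedSpace (EuclideanSpace ℝ (Fin n)) M]
  [RiemannianBundle (fun x : M => TangentSpace (𝓡 n) x)]
  {N : Type*} [TopologicalSpace N] [ChartedSpace (EuclideanSpace ℝ (Fin n)) N]

/-- `D` has a sector domain around its boundary point `p`, modelled on the cones over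
`a × Bⁿ⁻¹⁻ᵏ` and `a × Sⁿ⁻²⁻ᵏ`, where `Bⁿ⁻¹⁻ᵏ` is the open unit ball of `ℝⁿ⁻¹⁻ᵏ` and `Sⁿ⁻²⁻ᵏ` the
unit sphere bounding it. To form the cones, `a ⊆ N` is replaced by a diffeomorphic copy `A` in
some `ℝᵐ`. -/
def HasSectorDomainAt (D : Set M) (p : M) (k : ℕ) (a : Set N) : Prop :=
  ∃ (m : ℕ) (A : Set (EuclideanSpace ℝ (Fin m)))
    (f : N → EuclideanSpace ℝ (Fin m)) (g : EuclideanSpace ℝ (Fin m) → N),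
    IsDiffeoOn (𝓡 n) (𝓡 m) f g a A ∧
    IsConeBase A (ball (0 : EuclideanSpace ℝ (Fin (n - 1 - k))) 1) ∧
    IsConeBase A (sphere (0 : EuclideanSpace ℝ (Fin (n - 1 - k))) 1) ∧
    ∃ (U : Set M)
      (lam : M → EuclideanSpace ℝ (Fin m) × EuclideanSpace ℝ (Fin (n - 1 - k)))
      (linv linv' : EuclideanSpace ℝ (Fin m) × EuclideanSpace ℝ (Fin (n - 1 - k)) → M),
      IsOpen U ∧ p ∈ U ∧
      IsDiffeoIntoCone n p (insert p (U ∩ D)) lam linv A (ball 0 1) ∧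
      IsDiffeoIntoCone n p (U ∩ frontier D) lam linv' A (sphere 0 1) ∧
      ∀ x ∈ A, ∀ y ∈ sphere (0 : EuclideanSpace ℝ (Fin (n - 1 - k))) 1,
        ∀ y' ∈ sphere (0 : EuclideanSpace ℝ (Fin (n - 1 - k))) 1, y ≠ y' →
        ∀ w w' : TangentSpace (𝓡 n) p,
          HasRayTangent p linv' (x, y) w → HasRayTangent p linv' (x, y') w' →
          ‖w‖⁻¹ • w ≠ ‖w'‖⁻¹ • w'

/-- Either `k = 0` and `a` is a finite set of points, or `0 < k < n - 1` and `a` is a compact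
connected `k`-dimensional submanifold. -/
def IsPregluedSet (k : ℕ) (a : Set N) : Prop :=
  (k = 0 ∧ a.Finite) ∨
    (0 < k ∧ k + 1 < n ∧ IsSmoothSubmanifold (n := n) k a ∧ IsCompact a ∧ IsConnected a)

variable (n) in
/-- `φ : Ω → D` is a gluing map of `D` with sample domain `Ω ⊆ N` and set `P` of glued points. -/
structure IsGluingMap (φ : N → M) (Ω : Set N) (D : Set M) (P : Set M) : Prop where
  isOpen_sample : IsOpen Ω
  isConnected_sample : IsConnected Ω
  isCompact_closure : IsCompact (closure Ω)
  smooth_boundary : HasSmoothBoundary (n := n) Ω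
  /-- `φ` is a diffeomorphism of `Ω` onto `D`. -/
  diffeo : ∃ ψ : M → N, IsDiffeoOn (𝓡 n) (𝓡 n) φ ψ Ω D
  /-- `φ` is smooth on a neighbourhood of the closure of `Ω`. -/
  smooth_ext : ∃ Ω' : Set N, IsOpen Ω' ∧ closure Ω ⊆ Ω' ∧ ContMDiffOn (𝓡 n) (𝓡 n) ∞ φ Ω'
  boundary : φ '' frontier Ω = frontier D
  finite_glued : P.Finite
  glued_subset : P ⊆ frontier D
  /-- Away from the glued points, `φ` is a homeomorphism of the boundaries. -/
  boundary_homeo : Topology.IsEmbedding ((frontier Ω \ φ ⁻¹' P).domRestrict φ)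
  /-- Away from the glued points, the boundary of `D` is Lipschitz. -/
  boundary_lipschitz : ∀ p ∈ frontier D \ P, IsLipschitzBoundaryAt n D p
  /-- At each glued point `p`, the preglued set `frontier Ω ∩ φ ⁻¹' {p}` is as required, the
  pulled back metric `φ^* g` degenerates on it if `k ≠ 0`, and `D` has a sector domain. -/
  glued : ∀ p ∈ P, ∃ k : ℕ,
    IsPregluedSet (n := n) k (frontier Ω ∩ φ ⁻¹' {p}) ∧
    (k ≠ 0 → ∀ q ∈ frontier Ω ∩ φ ⁻¹' {p}, ∃ v : TangentSpace (𝓡 n) q, v ≠ 0 ∧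
      ∀ w : TangentSpace (𝓡 n) q,
        inner ℝ (mfderiv (𝓡 n) (𝓡 n) φ q v) (mfderiv (𝓡 n) (𝓡 n) φ q w) = 0) ∧
    HasSectorDomainAt (n := n) D p k (frontier Ω ∩ φ ⁻¹' {p})

end Gluing

/-- The domain `D` in the Riemannian manifold `M` is quasi-Lipschitz: it has a gluing map
defined on a sample domain of some smooth `n`-manifold `N`. -/
def IsQuasiLipschitzDomain (n : ℕ) {M : Type u} [TopologicalSpace M]
    [ChartedSpace (EuclideanSpace ℝ (Fin n)) M]
    [RiemannianBundle (fun x : M => TangentSpace (𝓡 n) x)] (D : Set M) : Prop :=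
  IsOpen D ∧ IsConnected D ∧
  ∃ (N : Type v) (_ : TopologicalSpace N) (_ : T2Space N) (_ : SecondCountableTopology N)
    (_ : ChartedSpace (EuclideanSpace ℝ (Fin n)) N) (_ : IsManifold (𝓡 n) ∞ N)
    (φ : N → M) (Ω : Set N) (P : Set M), IsGluingMap n φ Ω D P

/-! ### The Sobolev space `W^{1,2}(D)`

Functions on `D` are represented by functions on `M`, whose values outside `D` (resp. outside
the closure of `D`, for functions that are continuous up to the boundary) are irrelevant. -/

section Sobolev

variable {n : ℕ} {M : Type*}

section Weak

variable [TopologicalSpace M] [ChartedSpace (EuclideanSpace ℝ (Fin n)) M]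

/-- The `i`-th component, in the chart `e`, of the covector field `θ`, as a function on the
target of `e`: the value of `θ` on the `i`-th coordinate vector field. -/
def covecCoord (θ : ∀ x : M, TangentSpace (𝓡 n) x →L[ℝ] ℝ)
    (e : OpenPartialHomeomorph M (EuclideanSpace ℝ (Fin n))) (i : Fin n)
    (y : EuclideanSpace ℝ (Fin n)) : ℝ :=
  θ (e.symm y) (mfderiv (𝓡 n) (𝓡 n) e.symm y (EuclideanSpace.single i (1 : ℝ)))

/-- The covector field `θ` is the weak differential of the function `u` on the open set `D`: in
every chart, its components are the weak partial derivatives of `u`. -/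
def IsWeakDifferential (D : Set M) (u : M → ℝ) (θ : ∀ x : M, TangentSpace (𝓡 n) x →L[ℝ] ℝ) :
    Prop :=
  ∀ e ∈ IsManifold.maximalAtlas (𝓡 n) ∞ M,
    LocallyIntegrableOn (fun y => u (e.symm y)) (e.target ∩ e.symm ⁻¹' D) volume ∧
    ∀ i : Fin n,
      LocallyIntegrableOn (covecCoord θ e i) (e.target ∩ e.symm ⁻¹' D) volume ∧
      ∀ ψ : EuclideanSpace ℝ (Fin n) → ℝ, ContDiff ℝ ∞ ψ → HasCompactSupport ψ →
        tsupport ψ ⊆ e.target ∩ e.symm ⁻¹' D →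
        ∫ y, u (e.symm y) * fderiv ℝ ψ y (EuclideanSpace.single i (1 : ℝ)) =
          -∫ y, covecCoord θ e i y * ψ y

end Weak

variable [EMetricSpace M] [MeasurableSpace M] [BorelSpace M]
  [ChartedSpace (EuclideanSpace ℝ (Fin n)) M]
  [RiemannianBundle (fun x : M => TangentSpace (𝓡 n) x)]

variable (n) in
/-- The Riemannian volume measure: on an `n`-dimensional Riemannian manifold it is the
`n`-dimensional Hausdorff measure of the Riemannian distance, normalized so as to be Lebesgue
measure in `ℝⁿ`. -/
def riemannianVolume : Measure M := μHE[n]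

/-- The norm of a covector at `x` with respect to the Riemannian metric: the supremum of
`|l v|` over the tangent vectors `v` with `‖v‖ ≤ 1`. -/
def covectorNorm {x : M} (l : TangentSpace (𝓡 n) x →L[ℝ] ℝ) : ℝ≥0∞ :=
  ⨆ (v : TangentSpace (𝓡 n) x) (_ : ‖v‖ ≤ 1), ENNReal.ofReal |l v|

/-- The squared norm `∫_D |u|² + |θ|²`, where `|θ|` is the norm of covectors with respect to
the Riemannian metric. -/
def energy (D : Set M) (u : M → ℝ) (θ : ∀ x : M, TangentSpace (𝓡 n) x →L[ℝ] ℝ) : ℝ≥0∞ :=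
  ∫⁻ x in D, (ENNReal.ofReal (u x ^ 2) + covectorNorm (θ x) ^ 2) ∂(riemannianVolume n)

variable (n) in
/-- The norm of `W^{1,2}(D)`: the square root of `∫_D |u|² + |du|²`, where `du` is the weak
differential of `u`. As `du` is unique up to null sets, the infimum is over equal values; it is
`∞` if `u` has no weak differential. -/
def sobolevNorm (D : Set M) (u : M → ℝ) : ℝ≥0∞ :=
  ⨅ (θ : ∀ x : M, TangentSpace (𝓡 n) x →L[ℝ] ℝ) (_ : IsWeakDifferential D u θ),
    energy D u θ ^ (1 / 2 : ℝ)

variable (n) in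
/-- The space `W^{1,2}(D)` of all `L²` functions on `D` with weak differential in `L²`. -/
def sobolevSpace (D : Set M) : Set (M → ℝ) :=
  {u | MemLp u 2 ((riemannianVolume n).restrict D) ∧
    ∃ θ : ∀ x : M, TangentSpace (𝓡 n) x →L[ℝ] ℝ, IsWeakDifferential D u θ ∧
      ∫⁻ x in D, covectorNorm (θ x) ^ 2 ∂(riemannianVolume n) < ⊤}

variable (n) in
/-- The closure of a set of functions in `W^{1,2}(D)`. -/
def sobolevClosure (D : Set M) (S : Set (M → ℝ)) : Set (M → ℝ) :=
  {u | u ∈ sobolevSpace n D ∧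
    ∀ ε : ℝ≥0∞, 0 < ε → ∃ f ∈ S ∩ sobolevSpace n D, sobolevNorm n D (u - f) < ε}

end Sobolev

/-! ### The four function spaces -/

section Spaces

variable (n : ℕ) {M : Type*}

section Smooth

variable [TopologicalSpace M] [ChartedSpace (EuclideanSpace ℝ (Fin n)) M]

/-- Smooth functions on `D` whose support has closure (in `M`) contained in `D`. -/
def Fcpt (D : Set M) : Set (M → ℝ) :=
  {u | ContMDiffOn (𝓡 n) 𝓘(ℝ, ℝ) ∞ u D ∧ closure (Function.support u ∩ D) ⊆ D}

/-- Functions in `C^∞(D) ∩ C^0(closure D)` that vanish on the boundary. -/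
def FZero (D : Set M) : Set (M → ℝ) :=
  {u | ContMDiffOn (𝓡 n) 𝓘(ℝ, ℝ) ∞ u D ∧ ContinuousOn u (closure D) ∧
    ∀ x ∈ frontier D, u x = 0}

/-- `u` is `C^1` up to the boundary of the open set `D`: `u` is continuous on the closure of `D`
and differentiable in `D`, and its differential extends to a covector field that is continuous on
the closure of `D`. -/
def IsC1UpToBoundary (D : Set M) (u : M → ℝ) : Prop :=
  ContinuousOn u (closure D) ∧ MDifferentiableOn (𝓡 n) 𝓘(ℝ, ℝ) u D ∧
    ∃ θ : ∀ x : M, TangentSpace (𝓡 n) x →L[ℝ] ℝ,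
      (∀ x ∈ D, ∀ v : TangentSpace (𝓡 n) x, θ x v = mfderiv (𝓡 n) 𝓘(ℝ, ℝ) u x v) ∧
      ∀ e ∈ IsManifold.maximalAtlas (𝓡 n) ∞ M, ∀ i : Fin n,
        ContinuousOn (covecCoord θ e i) (e.target ∩ e.symm ⁻¹' closure D)

/-- Functions in `C^∞(D) ∩ C^1(closure D)` that vanish on the boundary. -/
def FOne (D : Set M) : Set (M → ℝ) :=
  {u | ContMDiffOn (𝓡 n) 𝓘(ℝ, ℝ) ∞ u D ∧ IsC1UpToBoundary n D u ∧
    ∀ x ∈ frontier D, u x = 0}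

end Smooth

variable [EMetricSpace M] [MeasurableSpace M] [BorelSpace M]
  [ChartedSpace (EuclideanSpace ℝ (Fin n)) M]
  [RiemannianBundle (fun x : M => TangentSpace (𝓡 n) x)]

/-- Functions in `C^∞(D) ∩ C^0(closure D)` whose restriction to the boundary has zero `L²` norm
with respect to the `(n-1)`-dimensional hypersurface measure. -/
def FL2 (D : Set M) : Set (M → ℝ) :=
  {u | ContMDiffOn (𝓡 n) 𝓘(ℝ, ℝ) ∞ u D ∧ ContinuousOn u (closure D) ∧
    eLpNorm u 2 ((μHE[n - 1] : Measure M).restrict (frontier D)) = 0}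

/-- The space `H(D)`: the closure of `FL2 D` in `W^{1,2}(D)`. -/
def H (D : Set M) : Set (M → ℝ) :=
  sobolevClosure n D (FL2 n D)

/-- The space `W^{1,2}_0(D)`: the closure of `Fcpt D` in `W^{1,2}(D)`. -/
def sobolevSpaceZero (D : Set M) : Set (M → ℝ) :=
  sobolevClosure n D (Fcpt n D)

end Spaces

end QuasiLipschitz

end

noncomputable section

set_option linter.unusedSectionVars false

namespace QuasiLipschitz

open Manifold NNReal

/-! ### Charts are locally bi-Lipschitz for the Riemannian distance. -/

section LocallyLipschitzCharts

/-! The inclusions `Fcpt` (after extension by zero) ⊆ `FOne` ⊆ `FZero` ⊆ `FL2` pass to the closures,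
so it remains to get back from `FL2` to `Fcpt`. This takes two independent arguments.

Geometry: a function in `FL2` vanishes at every boundary point. Where the boundary is a Lipschitz
graph, projection along the vertical coordinate is Lipschitz and maps each boundary neighbourhood
onto a set containing a nonempty open subset of ℝⁿ⁻¹. The neighbourhood therefore has positive
hypersurface measure, and a continuous function that is zero almost everywhere is zero there
(`IsLipschitzBoundaryAt.measure_ne_zero`). If n ≥ 2, a glued point is the vertex of a cone in the
boundary, hence a limit of Lipschitz points, because there are only finitely many glued points. If n
≤ 1, the boundary measure is counting measure (`eq_zero_on_frontier_of_isGluingMap`).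

Analysis: on any open D, let f be smooth, of finite energy and zero on the boundary. Subtract
ε·`residue`(f/ε). The result vanishes where |f| ≤ ε, so its support stays away from the boundary.
The error has energy at most a constant times that of f on {|f| < 2ε}. These sets decrease to {f =
0}, where df = 0 almost everywhere, so the error tends to zero (`exists_energy_truncationError_lt`).

The norm is an infimum over weak differentials, and the volume is a Hausdorff measure. Charts are
locally bi-Lipschitz, so Lebesgue null sets in charts give null sets in M. Hence a weak differential
of a smooth function is almost everywhere the classical one. -/

theorem isContinuousRiemannianBundle_of_isContMDiff {n : ℕ} {M : Type*} [TopologicalSpace M]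
    [ChartedSpace (EuclideanSpace ℝ (Fin n)) M] [IsManifold (𝓡 n) ∞ M]
    [RiemannianBundle (fun x : M => TangentSpace (𝓡 n) x)]
    [h : IsContMDiffRiemannianBundle (𝓡 n) ∞ (EuclideanSpace ℝ (Fin n))
      (fun x : M => TangentSpace (𝓡 n) x)] :
    IsContinuousRiemannianBundle (EuclideanSpace ℝ (Fin n))
      (fun x : M => TangentSpace (𝓡 n) x) := by
  obtain ⟨g, hg, hg'⟩ := h.exists_contMDiff
  exact ⟨g, hg.continuous, hg'⟩

variable {n : ℕ} {M : Type*} [EMetricSpace M]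
  [ChartedSpace (EuclideanSpace ℝ (Fin n)) M] [IsManifold (𝓡 n) ∞ M]
  [RiemannianBundle (fun x : M => TangentSpace (𝓡 n) x)]
  [IsContinuousRiemannianBundle (EuclideanSpace ℝ (Fin n))
    (fun x : M => TangentSpace (𝓡 n) x)]

/-- The derivative of the preferred chart is the trivialization of the tangent bundle, which is
bounded near `x` because the metric is continuous. Naming the image `w` fixes its norm as the
Euclidean one. -/
theorem eventually_enorm_mfderiv_chartAt_le (x : M) :
    ∃ C : ℝ≥0, ∀ᶠ y in 𝓝 x, ∀ (v : TangentSpace (𝓡 n) y) (w : EuclideanSpace ℝ (Fin n)),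
      mfderiv (𝓡 n) (𝓡 n) (extChartAt (𝓡 n) x) y v = w → ‖w‖ₑ ≤ C * ‖v‖ₑ := by
  obtain ⟨C, C_pos, hC⟩ := eventually_norm_trivializationAt_lt (EuclideanSpace ℝ (Fin n))
    (fun x : M => TangentSpace (𝓡 n) x) x
  lift C to ℝ≥0 using C_pos.le
  refine ⟨C, ?_⟩
  filter_upwards [hC, chart_source_mem_nhds (EuclideanSpace ℝ (Fin n)) x] with y hy hys v w hw
  have h := TangentBundle.continuousLinearMapAt_trivializationAt (I := 𝓡 n) hys
  have hv := ContinuousLinearMap.le_of_opNorm_le _ hy.le v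
  have h' : (trivializationAt (EuclideanSpace ℝ (Fin n)) (fun x : M => TangentSpace (𝓡 n) x)
    x).continuousLinearMapAt ℝ y v = mfderiv (𝓡 n) (𝓡 n) (extChartAt (𝓡 n) x) y v := congr($h v)
  rw [hw] at h'
  rw [h'] at hv
  simp only [enorm, nnnorm, ← ENNReal.coe_mul, ENNReal.coe_le_coe]
  exact hv

theorem eventually_enorm_mfderiv_chartAt_symm_le (x : M) :
    ∃ C : ℝ≥0, ∀ᶠ z in 𝓝 (extChartAt (𝓡 n) x x), ∀ v : EuclideanSpace ℝ (Fin n),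
      ‖mfderiv (𝓡 n) (𝓡 n) (extChartAt (𝓡 n) x).symm z v‖ₑ ≤ C * ‖v‖ₑ := by
  obtain ⟨C, C_pos, hC⟩ := eventually_norm_symmL_trivializationAt_lt (EuclideanSpace ℝ (Fin n))
    (fun x : M => TangentSpace (𝓡 n) x) x
  lift C to ℝ≥0 using C_pos.le
  refine ⟨C, ?_⟩
  have h1 := (continuousAt_extChartAt_symm (I := 𝓡 n) x).eventually
    (show ∀ᶠ y in 𝓝 ((extChartAt (𝓡 n) x).symm (extChartAt (𝓡 n) x x)), _ by
      rw [extChartAt_to_inv (I := 𝓡 n) x]; exact hC)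
  filter_upwards [h1, extChartAt_target_mem_nhds (I := 𝓡 n) x] with z hz hzt v
  have hs : (extChartAt (𝓡 n) x).symm z ∈ (chartAt (EuclideanSpace ℝ (Fin n)) x).source := by
    simpa only [extChartAt_source] using (extChartAt (𝓡 n) x).map_target hzt
  have h := TangentBundle.symmL_trivializationAt (I := 𝓡 n) hs
  have hv := ContinuousLinearMap.le_of_opNorm_le _ hz.le v
  have h' : (trivializationAt (EuclideanSpace ℝ (Fin n)) (fun x : M => TangentSpace (𝓡 n) x)
    x).symmL ℝ ((extChartAt (𝓡 n) x).symm z) v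
      = mfderiv (𝓡 n) (𝓡 n) (extChartAt (𝓡 n) x).symm z v := by
    have := congr($h v)
    rw [(extChartAt (𝓡 n) x).right_inv hzt, ModelWithCorners.range_eq_univ,
      mfderivWithin_univ] at this
    exact this
  rw [h'] at hv
  simp only [enorm, nnnorm, ← ENNReal.coe_mul, ENNReal.coe_le_coe]
  exact hv

variable [IsRiemannianManifold (𝓡 n) M]

/-- In a small ball, which is convex, the inverse chart maps a segment to a curve of length at most
`C` times that of the segment, and the distance in `M` is an infimum of lengths. -/
theorem exists_lipschitzOnWith_extChartAt_symm (x : M) :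
    ∃ C : ℝ≥0, ∃ s ∈ 𝓝 (extChartAt (𝓡 n) x x),
      s ⊆ (extChartAt (𝓡 n) x).target ∧ LipschitzOnWith C (extChartAt (𝓡 n) x).symm s := by
  obtain ⟨C, hC⟩ := eventually_enorm_mfderiv_chartAt_symm_le (n := n) x
  obtain ⟨r, r_pos, hr⟩ := Metric.mem_nhds_iff.1
    (inter_mem (extChartAt_target_mem_nhds (I := 𝓡 n) x) hC)
  refine ⟨C, _, ball_mem_nhds _ r_pos, fun z hz => (hr hz).1, fun a ha b hb => ?_⟩
  let η := ContinuousAffineMap.lineMap (R := ℝ) a b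
  set γ := (extChartAt (𝓡 n) x).symm ∘ η
  have hη : MapsTo η (Icc 0 1) (ball (extChartAt (𝓡 n) x x) r) := by
    rw [mapsTo_iff_image_subset, ContinuousAffineMap.coe_lineMap_eq, ← segment_eq_image_lineMap]
    exact (convex_ball _ _).segment_subset ha hb
  have η_smooth : ContMDiffOn 𝓘(ℝ, ℝ) (𝓡 n) 1 η (Icc 0 1) := by
    apply ContMDiff.contMDiffOn
    rw [contMDiff_iff_contDiff]
    exact ContinuousAffineMap.contDiff _
  rw [IsRiemannianManifold.out (I := 𝓡 n)]
  have hle : riemannianEDist (𝓡 n) ((extChartAt (𝓡 n) x).symm a) ((extChartAt (𝓡 n) x).symm b)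
      ≤ pathELength (𝓡 n) γ 0 1 := by
    apply riemannianEDist_le_pathELength _ _ _ zero_le_one
    · exact (contMDiffOn_extChartAt_symm x).comp η_smooth (fun t ht => (hr (hη ht)).1)
    · simp [γ, η, ContinuousAffineMap.coe_lineMap_eq]
    · simp [γ, η, ContinuousAffineMap.coe_lineMap_eq]
  refine hle.trans ?_
  rw [← lintegral_fderiv_lineMap_eq_edist, pathELength_eq_lintegral_mfderivWithin_Icc,
    ← lintegral_const_mul' _ _ ENNReal.coe_ne_top]
  refine setLIntegral_mono' measurableSet_Icc (fun t ht ↦ ?_)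
  have h1 : mfderivWithin 𝓘(ℝ, ℝ) (𝓡 n) γ (Icc 0 1) t =
      (mfderiv (𝓡 n) (𝓡 n) (extChartAt (𝓡 n) x).symm (η t)) ∘L
        (mfderivWithin 𝓘(ℝ, ℝ) (𝓡 n) η (Icc 0 1) t) := by
    apply mfderiv_comp_mfderivWithin
    · have := mdifferentiableWithinAt_extChartAt_symm (I := 𝓡 n) (hr (hη ht)).1
      rwa [ModelWithCorners.range_eq_univ, mdifferentiableWithinAt_univ] at this
    · exact η_smooth.mdifferentiableOn one_ne_zero t ht
    · rw [uniqueMDiffWithinAt_iff_uniqueDiffWithinAt]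
      exact uniqueDiffOn_Icc zero_lt_one t ht
  have h2 : mfderivWithin 𝓘(ℝ, ℝ) (𝓡 n) γ (Icc 0 1) t 1 =
      (mfderiv (𝓡 n) (𝓡 n) (extChartAt (𝓡 n) x).symm (η t))
        (mfderivWithin 𝓘(ℝ, ℝ) (𝓡 n) η (Icc 0 1) t 1) := congr($h1 1)
  rw [h2, ← mfderivWithin_eq_fderivWithin]
  exact (hr (hη ht)).2 _

/-- The chart maps a nearly shortest curve to one at most `C` times as long, provided the curve does
not leave the ball where the derivative bound holds. -/
theorem exists_lipschitzOnWith_extChartAt (x : M) :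
    ∃ C : ℝ≥0, ∃ s ∈ 𝓝 x, LipschitzOnWith C (extChartAt (𝓡 n) x) s := by
  obtain ⟨C, hC⟩ := eventually_enorm_mfderiv_chartAt_le (n := n) x
  obtain ⟨r, r_pos, hr⟩ := EMetric.mem_nhds_iff.1
    (inter_mem (extChartAt_source_mem_nhds (I := 𝓡 n) x) hC)
  -- Points within `r / 3` of `x` are less than `2r / 3` apart. A joining curve shorter than `2r /
  -- 3` then stays within `r` of `x`.
  have r3 : 0 < r / 3 := ENNReal.div_pos r_pos.ne' (by simp)
  refine ⟨C, _, Metric.eball_mem_nhds x r3, fun a ha b hb => ?_⟩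
  have hab : edist a b < r / 3 + r / 3 := by
    refine (edist_triangle_right a b x).trans_lt ?_
    exact ENNReal.add_lt_add ha hb
  -- The distance need not be attained by a curve, so the bound is proved for every slightly larger
  -- `c`, followed by a limit.
  have hne : NeBot (𝓝[>] (edist a b)) := nhdsGT_neBot_of_exists_gt ⟨_, hab⟩
  have hlim : Tendsto (fun c : ℝ≥0∞ => C * c) (𝓝[>] (edist a b)) (𝓝 (C * edist a b)) :=
    ((ENNReal.continuous_const_mul (ENNReal.coe_ne_top (r := C))).tendsto
      (edist a b)).mono_left nhdsWithin_le_nhds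
  refine ge_of_tendsto hlim ?_
  filter_upwards [Ioo_mem_nhdsGT hab] with c hc
  have hc1 := hc.1
  rw [IsRiemannianManifold.out (I := 𝓡 n)] at hc1
  obtain ⟨γ, hγa, hγb, γ_smooth, hγ⟩ := exists_lt_of_riemannianEDist_lt hc1
  have hmem : ∀ t ∈ Icc (0 : ℝ) 1, γ t ∈ eball x r := by
    intro t ht
    have h1 : edist a (γ t) ≤ pathELength (𝓡 n) γ 0 t := by
      rw [IsRiemannianManifold.out (I := 𝓡 n)]
      exact riemannianEDist_le_pathELength (γ_smooth.mono (Icc_subset_Icc_right ht.2)) hγa rfl ht.1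
    have h2 : edist a (γ t) < r / 3 + r / 3 :=
      (h1.trans (pathELength_mono le_rfl ht.2)).trans_lt (hγ.trans hc.2)
    have h3 : edist (γ t) x < r / 3 + r / 3 + r / 3 := by
      refine (edist_triangle_left (γ t) x a).trans_lt ?_
      exact ENNReal.add_lt_add h2 ha
    rwa [ENNReal.add_thirds] at h3
  have hcont : ContMDiffOn 𝓘(ℝ, ℝ) (𝓡 n) 1 (extChartAt (𝓡 n) x ∘ γ) (Icc 0 1) :=
    contMDiffOn_extChartAt.comp (I' := 𝓡 n) (t := (chartAt _ x).source) γ_smooth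
      (fun t ht => by
        rw [mem_preimage, ← extChartAt_source (𝓡 n)]
        exact (hr (hmem t ht)).1)
  calc edist (extChartAt (𝓡 n) x a) (extChartAt (𝓡 n) x b)
    _ = ‖(extChartAt (𝓡 n) x ∘ γ) 1 - (extChartAt (𝓡 n) x ∘ γ) 0‖ₑ := by
      rw [edist_comm, edist_eq_enorm_sub, Function.comp, Function.comp, hγa, hγb]
    _ ≤ ∫⁻ t in Icc (0 : ℝ) 1, ‖derivWithin (extChartAt (𝓡 n) x ∘ γ) (Icc 0 1) t‖ₑ := by
      apply enorm_sub_le_lintegral_derivWithin_Icc_of_contDiffOn_Icc _ zero_le_one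
      rwa [← contMDiffOn_iff_contDiffOn]
    _ ≤ ∫⁻ t in Icc (0 : ℝ) 1, C * ‖mfderivWithin 𝓘(ℝ, ℝ) (𝓡 n) γ (Icc 0 1) t 1‖ₑ := by
      refine setLIntegral_mono' measurableSet_Icc (fun t ht ↦ ?_)
      have h1 : mfderivWithin 𝓘(ℝ, ℝ) (𝓡 n) (extChartAt (𝓡 n) x ∘ γ) (Icc 0 1) t =
          (mfderiv (𝓡 n) (𝓡 n) (extChartAt (𝓡 n) x) (γ t)) ∘L
            (mfderivWithin 𝓘(ℝ, ℝ) (𝓡 n) γ (Icc 0 1) t) := by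
        apply mfderiv_comp_mfderivWithin
        · exact mdifferentiableAt_extChartAt
            (by simpa only [extChartAt_source] using (hr (hmem t ht)).1)
        · exact γ_smooth.mdifferentiableOn one_ne_zero _ ht
        · rw [uniqueMDiffWithinAt_iff_uniqueDiffWithinAt]
          exact uniqueDiffOn_Icc zero_lt_one _ ht
      have h2 : mfderivWithin 𝓘(ℝ, ℝ) (𝓡 n) (extChartAt (𝓡 n) x ∘ γ) (Icc 0 1) t 1 =
          (mfderiv (𝓡 n) (𝓡 n) (extChartAt (𝓡 n) x) (γ t))
            (mfderivWithin 𝓘(ℝ, ℝ) (𝓡 n) γ (Icc 0 1) t 1) := congr($h1 1)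
      refine (hr (hmem t ht)).2 _ _ ?_
      rw [← h2, ← fderivWithin_derivWithin, mfderivWithin_eq_fderivWithin]
      rfl
    _ = C * pathELength (𝓡 n) γ 0 1 := by
      rw [lintegral_const_mul' _ _ ENNReal.coe_ne_top, pathELength_eq_lintegral_mfderivWithin_Icc]
    _ ≤ C * c := by gcongr

/-- A chart of the maximal atlas is locally Lipschitz. -/
theorem exists_lipschitzOnWith_of_mem_maximalAtlas
    {e : OpenPartialHomeomorph M (EuclideanSpace ℝ (Fin n))}
    (he : e ∈ IsManifold.maximalAtlas (𝓡 n) ∞ M) {x : M} (hx : x ∈ e.source) :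
    ∃ C : ℝ≥0, ∃ s ∈ 𝓝 x, LipschitzOnWith C e s := by
  obtain ⟨C, s, hs, hC⟩ := exists_lipschitzOnWith_extChartAt (n := n) x
  -- The transition map from the preferred chart is C¹ between Euclidean spaces, hence locally
  -- Lipschitz.
  have h1 : ContMDiffAt (𝓡 n) (𝓡 n) 1 (e ∘ (extChartAt (𝓡 n) x).symm) (extChartAt (𝓡 n) x x) := by
    apply ContMDiffAt.comp (I' := 𝓡 n)
    · rw [extChartAt_to_inv]
      exact (contMDiffAt_of_mem_maximalAtlas he hx).of_le (by simp)
    · exact ((contMDiffOn_extChartAt_symm x).contMDiffAt (extChartAt_target_mem_nhds x))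
  obtain ⟨K, t, ht, hK⟩ := (contMDiffAt_iff_contDiffAt.1 h1).exists_lipschitzOnWith
  refine ⟨K * C, s ∩ (extChartAt (𝓡 n) x ⁻¹' t ∩ (extChartAt (𝓡 n) x).source),
    inter_mem hs (inter_mem ((continuousAt_extChartAt x).preimage_mem_nhds ht)
      (extChartAt_source_mem_nhds x)), ?_⟩
  intro a ha b hb
  have h2 := hK ha.2.1 hb.2.1
  simp only [Function.comp, (extChartAt (𝓡 n) x).left_inv ha.2.2,
    (extChartAt (𝓡 n) x).left_inv hb.2.2] at h2
  rw [ENNReal.coe_mul, mul_assoc]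
  exact h2.trans (by gcongr; exact hC ha.1 hb.1)

end LocallyLipschitzCharts

/-! ### Null sets of the Riemannian volume, read in charts. -/

section HausdorffNull

theorem euclideanHausdorffMeasure_eq_zero_iff {X : Type*} [EMetricSpace X] [MeasurableSpace X]
    [BorelSpace X] (d : ℕ) (s : Set X) :
    (μHE[d] : Measure X) s = 0 ↔ (Measure.hausdorffMeasure (d : ℝ) : Measure X) s = 0 := by
  rw [Measure.euclideanHausdorffMeasure_def, Measure.smul_apply, ENNReal.smul_def, smul_eq_mul,
    mul_eq_zero, ENNReal.coe_eq_zero,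
    or_iff_right (Measure.addHaarScalarFactor_volume_hausdorffMeasure_ne_zero d)]

theorem euclideanHausdorffMeasure_image_eq_zero {X Y : Type*} [EMetricSpace X] [MeasurableSpace X]
    [BorelSpace X] [EMetricSpace Y] [MeasurableSpace Y] [BorelSpace Y] {d : ℕ} {K : ℝ≥0}
    {f : X → Y} {s : Set X} (hf : LipschitzOnWith K f s) (hs : (μHE[d] : Measure X) s = 0) :
    (μHE[d] : Measure Y) (f '' s) = 0 := by
  rw [euclideanHausdorffMeasure_eq_zero_iff] at hs ⊢
  have h := hf.hausdorffMeasure_image_le (d := d) (Nat.cast_nonneg d)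
  rw [hs, mul_zero] at h
  exact le_antisymm h zero_le

variable {n : ℕ} {M : Type*} [EMetricSpace M] [SecondCountableTopology M]
  [MeasurableSpace M] [BorelSpace M]
  [ChartedSpace (EuclideanSpace ℝ (Fin n)) M] [IsManifold (𝓡 n) ∞ M]
  [RiemannianBundle (fun x : M => TangentSpace (𝓡 n) x)]
  [IsContinuousRiemannianBundle (EuclideanSpace ℝ (Fin n))
    (fun x : M => TangentSpace (𝓡 n) x)]
  [IsRiemannianManifold (𝓡 n) M]

/-- A property that holds almost everywhere in each preferred chart holds almost everywhere for
the Riemannian volume. -/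
theorem ae_restrict_riemannianVolume_of_chart {D : Set M} (hD : IsOpen D) {Q : M → Prop}
    (h : ∀ x ∈ D, ∀ᵐ y ∂(volume : Measure (EuclideanSpace ℝ (Fin n))),
      y ∈ (chartAt (EuclideanSpace ℝ (Fin n)) x).target ∩
        (chartAt (EuclideanSpace ℝ (Fin n)) x).symm ⁻¹' D →
      Q ((chartAt (EuclideanSpace ℝ (Fin n)) x).symm y)) :
    ∀ᵐ x ∂(riemannianVolume n : Measure M).restrict D, Q x := by
  rw [ae_restrict_iff' hD.measurableSet, ae_iff]
  -- By second countability one chart at a time suffices. There the exceptional set lies in the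
  -- image of a Lebesgue null set under the locally Lipschitz inverse chart.
  refine measure_null_of_locally_null _ (fun x hx => ?_)
  have hxD : x ∈ D := by
    by_contra hxD
    exact hx fun h => (hxD h).elim
  obtain ⟨K, s, hs, -, hK⟩ := exists_lipschitzOnWith_extChartAt_symm (n := n) x
  have hB := h x hxD
  rw [ae_iff] at hB
  set B := {y | ¬(y ∈ (chartAt (EuclideanSpace ℝ (Fin n)) x).target ∩
        (chartAt (EuclideanSpace ℝ (Fin n)) x).symm ⁻¹' D →
      Q ((chartAt (EuclideanSpace ℝ (Fin n)) x).symm y))} with hBdef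
  refine ⟨(extChartAt (𝓡 n) x).symm '' (B ∩ s), ?_, ?_⟩
  · have h1 := inter_mem ((continuousAt_extChartAt (I := 𝓡 n) x).preimage_mem_nhds hs)
      (extChartAt_source_mem_nhds (I := 𝓡 n) x)
    filter_upwards [self_mem_nhdsWithin, mem_nhdsWithin_of_mem_nhds h1] with z hz hz'
    have hinv := (extChartAt (𝓡 n) x).left_inv hz'.2
    refine ⟨extChartAt (𝓡 n) x z, ⟨?_, hz'.1⟩, hinv⟩
    have htarget := (extChartAt (𝓡 n) x).map_source hz'.2
    simp only [hBdef, mem_ofPred_eq, Classical.not_imp] at hz ⊢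
    simp only [mfld_simps] at hinv htarget hz' ⊢
    rw [hinv]
    exact ⟨⟨htarget, hz.1⟩, hz.2⟩
  · refine euclideanHausdorffMeasure_image_eq_zero (hK.mono inter_subset_right)
      (measure_mono_null inter_subset_left ?_)
    rwa [EuclideanSpace.euclideanHausdorffMeasure_eq_volume]

end HausdorffNull

/-! ### Integration by parts and differentials on zero sets in Euclidean space. -/

section Euclidean

theorem integrable_mul_of_locallyIntegrableOn {E : Type*} [NormedAddCommGroup E]
    [MeasurableSpace E] [BorelSpace E] {μ : Measure E} {Ω : Set E} {g φ : E → ℝ}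
    (hg : LocallyIntegrableOn g Ω μ) (hφ : Continuous φ) (hc : HasCompactSupport φ)
    (hs : tsupport φ ⊆ Ω) : Integrable (fun y => g y * φ y) μ := by
  have h1 : IntegrableOn g (tsupport φ) μ := hg.integrableOn_compact_subset hs hc
  have h2 : IntegrableOn (fun y => g y * φ y) (tsupport φ) μ :=
    h1.mul_continuousOn hφ.continuousOn hc
  rwa [integrableOn_iff_integrable_of_support_subset] at h2
  intro y hy
  exact subset_tsupport φ (right_ne_zero_of_mul hy)

variable {E : Type*} [NormedAddCommGroup E] [NormedSpace ℝ E] [FiniteDimensional ℝ E]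
  [MeasurableSpace E] [BorelSpace E] {μ : Measure E}

theorem integral_mul_fderiv_of_contDiffOn [μ.IsAddHaarMeasure] {Ω : Set E} (hΩ : IsOpen Ω)
    {g φ : E → ℝ} (hg : ContDiffOn ℝ 1 g Ω) (hφ : ContDiff ℝ 1 φ) (hc : HasCompactSupport φ)
    (hs : tsupport φ ⊆ Ω) (v : E) :
    ∫ y, g y * fderiv ℝ φ y v ∂μ = -∫ y, fderiv ℝ g y v * φ y ∂μ := by
  have hsub : tsupport (fun y => fderiv ℝ φ y v) ⊆ tsupport φ :=
    tsupport_fderiv_apply_subset ℝ v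
  have hφ' : Continuous fun y => fderiv ℝ φ y v :=
    (hφ.continuous_fderiv one_ne_zero).clm_apply continuous_const
  have i1 : Integrable (fun y => g y * fderiv ℝ φ y v) μ :=
    integrable_mul_of_locallyIntegrableOn
      (hg.continuousOn.locallyIntegrableOn hΩ.measurableSet) hφ'
      (hc.fderiv_apply ℝ v) (hsub.trans hs)
  have i2 : Integrable (fun y => fderiv ℝ g y v * φ y) μ :=
    integrable_mul_of_locallyIntegrableOn
      (((hg.continuousOn_fderiv_of_isOpen hΩ le_rfl).clm_apply
        continuousOn_const).locallyIntegrableOn hΩ.measurableSet) hφ.continuous hc hs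
  have i3 : Integrable (fun y => g y * φ y) μ :=
    integrable_mul_of_locallyIntegrableOn
      (hg.continuousOn.locallyIntegrableOn hΩ.measurableSet) hφ.continuous hc hs
  exact integral_mul_fderiv_eq_neg_fderiv_mul_of_integrable i2 i1 i3
    (fun y hy => ((hg y (hs hy)).contDiffAt (hΩ.mem_nhds (hs hy))).differentiableAt one_ne_zero)
    (fun y _ => hφ.differentiable one_ne_zero y)

/-- The differential of a function vanishes almost everywhere on the zero set. -/
theorem ae_fderiv_eq_zero_of_eq_zero [μ.IsAddHaarMeasure] {Ω : Set E} (hΩ : IsOpen Ω) {g : E → ℝ}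
    (hg : DifferentiableOn ℝ g Ω) : ∀ᵐ y ∂μ, y ∈ Ω → g y = 0 → fderiv ℝ g y = 0 := by
  set s : Set E := Ω ∩ g ⁻¹' {0}
  have hs : MeasurableSet s := by
    have h : s = Ω \ (Ω ∩ g ⁻¹' {0}ᶜ) := by ext; simp [s]
    rw [h]
    exact hΩ.measurableSet.diff
      (hg.continuousOn.isOpen_inter_preimage hΩ isOpen_compl_singleton).measurableSet
  rcases subsingleton_or_nontrivial E with hE | hE
  · exact Eventually.of_forall fun y _ _ => Subsingleton.elim _ _
  -- The density-point lemma used below is about maps from `E` to itself, so `g` is replaced by `g •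
  -- v`. On the zero set this map agrees with the zero linear map, with error constant 0.
  obtain ⟨v, hv⟩ := exists_ne (0 : E)
  have happrox : ApproximatesLinearOn (fun y => g y • v) (0 : E →L[ℝ] E) s 0 := by
    intro x hx y hy
    have hx0 : g x = 0 := hx.2
    have hy0 : g y = 0 := hy.2
    simp [hx0, hy0]
  have h := happrox.norm_fderiv_sub_le μ hs (fun y => (fderiv ℝ g y).smulRight v) (fun y hy =>
    (((hg y hy.1).differentiableAt (hΩ.mem_nhds hy.1)).hasFDerivAt.smul_const v).hasFDerivWithinAt)
  rw [ae_restrict_iff' hs] at h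
  filter_upwards [h] with y hy hyΩ hy0
  have h1 := hy ⟨hyΩ, hy0⟩
  rw [sub_zero, nonpos_iff_eq_zero, nnnorm_eq_zero] at h1
  ext w
  have h2 := congr($h1 w)
  simpa [hv] using h2

end Euclidean

/-! ### Classical and weak differentials on a manifold. -/

section Differential

variable {n : ℕ} {M : Type*} [TopologicalSpace M] [ChartedSpace (EuclideanSpace ℝ (Fin n)) M]

variable (n) in
/-- The classical differential of a function, as a covector field. -/
def differential (f : M → ℝ) (x : M) : TangentSpace (𝓡 n) x →L[ℝ] ℝ :=
  mfderiv (𝓡 n) 𝓘(ℝ, ℝ) f x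

/-- The domain, in the chart `e`, of functions defined on `D`. -/
abbrev chartDomain (D : Set M) (e : OpenPartialHomeomorph M (EuclideanSpace ℝ (Fin n))) :
    Set (EuclideanSpace ℝ (Fin n)) :=
  e.target ∩ e.symm ⁻¹' D

theorem isOpen_chartDomain {D : Set M} (hD : IsOpen D)
    (e : OpenPartialHomeomorph M (EuclideanSpace ℝ (Fin n))) : IsOpen (chartDomain D e) :=
  e.isOpen_inter_preimage_symm hD

variable [IsManifold (𝓡 n) ∞ M] {e : OpenPartialHomeomorph M (EuclideanSpace ℝ (Fin n))}
  {D : Set M} {f : M → ℝ}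

theorem contDiffOn_comp_symm_of_mem_maximalAtlas (he : e ∈ IsManifold.maximalAtlas (𝓡 n) ∞ M)
    (hf : ContMDiffOn (𝓡 n) 𝓘(ℝ, ℝ) ∞ f D) :
    ContDiffOn ℝ ∞ (fun y => f (e.symm y)) (chartDomain D e) :=
  contMDiffOn_iff_contDiffOn.1 <| hf.comp
    ((contMDiffOn_symm_of_mem_maximalAtlas he).mono inter_subset_left) (fun _ hy => hy.2)

theorem mdifferentiableAt_symm_of_mem_maximalAtlas
    (he : e ∈ IsManifold.maximalAtlas (𝓡 n) ∞ M) {y : EuclideanSpace ℝ (Fin n)}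
    (hy : y ∈ e.target) : MDifferentiableAt (𝓡 n) (𝓡 n) e.symm y :=
  (contMDiffAt_symm_of_mem_maximalAtlas he hy).mdifferentiableAt (by simp)

theorem differential_mfderiv_symm (he : e ∈ IsManifold.maximalAtlas (𝓡 n) ∞ M)
    {y : EuclideanSpace ℝ (Fin n)} (hy : y ∈ e.target)
    (hf : MDifferentiableAt (𝓡 n) 𝓘(ℝ, ℝ) f (e.symm y)) (v : EuclideanSpace ℝ (Fin n)) :
    differential n f (e.symm y) (mfderiv (𝓡 n) (𝓡 n) e.symm y v) =
      fderiv ℝ (fun y => f (e.symm y)) y v := by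
  have h : mfderiv (𝓡 n) 𝓘(ℝ, ℝ) (f ∘ e.symm) y = _ :=
    mfderiv_comp y hf (mdifferentiableAt_symm_of_mem_maximalAtlas he hy)
  rw [mfderiv_eq_fderiv] at h
  exact congr($h.symm v)

theorem covecCoord_differential (he : e ∈ IsManifold.maximalAtlas (𝓡 n) ∞ M)
    {y : EuclideanSpace ℝ (Fin n)} (hy : y ∈ e.target)
    (hf : MDifferentiableAt (𝓡 n) 𝓘(ℝ, ℝ) f (e.symm y)) (i : Fin n) :
    covecCoord (differential n f) e i y =
      fderiv ℝ (fun y => f (e.symm y)) y (EuclideanSpace.single i (1 : ℝ)) :=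
  differential_mfderiv_symm he hy hf _

theorem mdifferentiableAt_of_contMDiffOn (hD : IsOpen D) (hf : ContMDiffOn (𝓡 n) 𝓘(ℝ, ℝ) ∞ f D)
    {x : M} (hx : x ∈ D) : MDifferentiableAt (𝓡 n) 𝓘(ℝ, ℝ) f x :=
  ((hf x hx).contMDiffAt (hD.mem_nhds hx)).mdifferentiableAt (by simp)

theorem continuousOn_covecCoord_differential (hD : IsOpen D)
    (he : e ∈ IsManifold.maximalAtlas (𝓡 n) ∞ M) (hf : ContMDiffOn (𝓡 n) 𝓘(ℝ, ℝ) ∞ f D)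
    (i : Fin n) : ContinuousOn (covecCoord (differential n f) e i) (chartDomain D e) := by
  have h := ((contDiffOn_comp_symm_of_mem_maximalAtlas he hf).continuousOn_fderiv_of_isOpen
    (isOpen_chartDomain hD e) (by simp)).clm_apply
      (continuousOn_const (c := EuclideanSpace.single i (1 : ℝ)))
  exact h.congr fun y hy =>
    covecCoord_differential he hy.1 (mdifferentiableAt_of_contMDiffOn hD hf hy.2) i

/-- The differential of a smooth function is a weak differential. -/
theorem isWeakDifferential_differential (hD : IsOpen D)
    (hf : ContMDiffOn (𝓡 n) 𝓘(ℝ, ℝ) ∞ f D) : IsWeakDifferential D f (differential n f) := by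
  intro e he
  have hsm := contDiffOn_comp_symm_of_mem_maximalAtlas he hf
  have hopen := isOpen_chartDomain hD e
  refine ⟨hsm.continuousOn.locallyIntegrableOn hopen.measurableSet, fun i =>
    ⟨(continuousOn_covecCoord_differential hD he hf i).locallyIntegrableOn hopen.measurableSet,
      fun ψ hψ hc hs => ?_⟩⟩
  rw [integral_mul_fderiv_of_contDiffOn hopen (hsm.of_le (by simp)) (hψ.of_le (by simp)) hc hs]
  congr 1
  refine integral_congr_ae (Eventually.of_forall fun y => ?_)
  by_cases hy : y ∈ tsupport ψ
  · simp only
    rw [covecCoord_differential he (hs hy).1 (mdifferentiableAt_of_contMDiffOn hD hf (hs hy).2)]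
  · simp [image_eq_zero_of_notMem_tsupport hy]

theorem IsWeakDifferential.congr {u u' : M → ℝ} {θ : ∀ x : M, TangentSpace (𝓡 n) x →L[ℝ] ℝ}
    (hD : IsOpen D) (h : IsWeakDifferential D u θ) (huu' : EqOn u u' D) :
    IsWeakDifferential D u' θ := by
  intro e he
  obtain ⟨h1, h2⟩ := h e he
  have heq : EqOn (fun y => u (e.symm y)) (fun y => u' (e.symm y)) (chartDomain D e) :=
    fun y hy => huu' hy.2
  have hae := (ae_restrict_mem (μ := volume) (isOpen_chartDomain hD e).measurableSet).mono
    fun y hy => heq hy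
  refine ⟨(locallyIntegrableOn_congr hae).1 h1, fun i => ⟨(h2 i).1, fun ψ hψ hc hs => ?_⟩⟩
  rw [← (h2 i).2 ψ hψ hc hs]
  refine integral_congr_ae (Eventually.of_forall fun y => ?_)
  by_cases hy : y ∈ tsupport ψ
  · simp only
    rw [huu' (hs hy).2]
  · simp only
    rw [image_eq_zero_of_notMem_tsupport
      (fun h => hy (tsupport_fderiv_apply_subset ℝ (EuclideanSpace.single i (1 : ℝ)) h))]
    simp

theorem IsWeakDifferential.add {u u' : M → ℝ} {θ θ' : ∀ x : M, TangentSpace (𝓡 n) x →L[ℝ] ℝ}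
    (h : IsWeakDifferential D u θ) (h' : IsWeakDifferential D u' θ') :
    IsWeakDifferential D (u + u') (fun x => θ x + θ' x) := by
  intro e he
  obtain ⟨h1, h2⟩ := h e he
  obtain ⟨h1', h2'⟩ := h' e he
  refine ⟨h1.add h1', fun i => ⟨(h2 i).1.add (h2' i).1, fun ψ hψ hc hs => ?_⟩⟩
  have hφ : Continuous fun y => fderiv ℝ ψ y (EuclideanSpace.single i (1 : ℝ)) :=
    (hψ.continuous_fderiv (by simp)).clm_apply continuous_const
  have hφs : tsupport (fun y => fderiv ℝ ψ y (EuclideanSpace.single i (1 : ℝ))) ⊆ _ :=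
    (tsupport_fderiv_apply_subset ℝ _).trans hs
  have hφc := hc.fderiv_apply ℝ (EuclideanSpace.single i (1 : ℝ))
  have e1 : ∀ y, covecCoord (fun x => θ x + θ' x) e i y * ψ y =
      covecCoord θ e i y * ψ y + covecCoord θ' e i y * ψ y := fun y => by
    simp [covecCoord, add_mul]
  simp_rw [e1, Pi.add_apply, add_mul]
  rw [integral_add (integrable_mul_of_locallyIntegrableOn h1 hφ hφc hφs)
      (integrable_mul_of_locallyIntegrableOn h1' hφ hφc hφs),
    integral_add (integrable_mul_of_locallyIntegrableOn (h2 i).1 hψ.continuous hc hs)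
      (integrable_mul_of_locallyIntegrableOn (h2' i).1 hψ.continuous hc hs),
    (h2 i).2 ψ hψ hc hs, (h2' i).2 ψ hψ hc hs]
  ring

/-- Weak differentials are unique almost everywhere in each chart. -/
theorem IsWeakDifferential.ae_covecCoord_eq {u : M → ℝ}
    {θ θ' : ∀ x : M, TangentSpace (𝓡 n) x →L[ℝ] ℝ} (hD : IsOpen D)
    (h : IsWeakDifferential D u θ) (h' : IsWeakDifferential D u θ')
    (he : e ∈ IsManifold.maximalAtlas (𝓡 n) ∞ M) (i : Fin n) :
    ∀ᵐ y, y ∈ chartDomain D e → covecCoord θ e i y = covecCoord θ' e i y := by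
  obtain ⟨-, h2⟩ := h e he
  obtain ⟨-, h2'⟩ := h' e he
  have hz := (isOpen_chartDomain hD e).ae_eq_zero_of_integral_contDiff_smul_eq_zero
    ((h2 i).1.sub (h2' i).1) (fun ψ hψ hc hs => by
      have e1 : ∀ y, ψ y • (covecCoord θ e i - covecCoord θ' e i) y =
        covecCoord θ e i y * ψ y - covecCoord θ' e i y * ψ y := fun y => by
          simp only [Pi.sub_apply, smul_eq_mul]; ring
      simp_rw [e1]
      rw [integral_sub (integrable_mul_of_locallyIntegrableOn (h2 i).1 hψ.continuous hc hs)
        (integrable_mul_of_locallyIntegrableOn (h2' i).1 hψ.continuous hc hs), sub_eq_zero,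
        ← neg_inj, ← (h2 i).2 ψ hψ hc hs, ← (h2' i).2 ψ hψ hc hs])
  filter_upwards [hz] with y hy hyD
  exact sub_eq_zero.1 (hy hyD)

/-- The coordinate vector fields span each tangent space: by the chain rule for `e.symm ∘ e`, the
derivative of the inverse chart is onto. -/
theorem eq_of_covecCoord_eq (he : e ∈ IsManifold.maximalAtlas (𝓡 n) ∞ M)
    {θ θ' : ∀ x : M, TangentSpace (𝓡 n) x →L[ℝ] ℝ} {y : EuclideanSpace ℝ (Fin n)}
    (hy : y ∈ e.target) (h : ∀ i, covecCoord θ e i y = covecCoord θ' e i y) :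
    θ (e.symm y) = θ' (e.symm y) := by
  have hmd : MDifferentiableAt (𝓡 n) (𝓡 n) e (e.symm y) :=
    (contMDiffAt_of_mem_maximalAtlas he (e.map_target hy)).mdifferentiableAt (by simp)
  have hmd' := mdifferentiableAt_symm_of_mem_maximalAtlas he hy
  let A : EuclideanSpace ℝ (Fin n) →L[ℝ] ℝ := (θ (e.symm y)).comp (mfderiv (𝓡 n) (𝓡 n) e.symm y)
  let B : EuclideanSpace ℝ (Fin n) →L[ℝ] ℝ := (θ' (e.symm y)).comp (mfderiv (𝓡 n) (𝓡 n) e.symm y)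
  have hAB : A = B := by
    refine ContinuousLinearMap.coe_injective
      ((EuclideanSpace.basisFun (Fin n) ℝ).toBasis.ext fun i => ?_)
    rw [OrthonormalBasis.coe_toBasis, EuclideanSpace.basisFun_apply]
    exact h i
  have hsurj : ∀ w : TangentSpace (𝓡 n) (e.symm y),
      ∃ v : EuclideanSpace ℝ (Fin n), mfderiv (𝓡 n) (𝓡 n) e.symm y v = w := by
    intro w
    have h1 : mfderiv (𝓡 n) (𝓡 n) (e.symm ∘ e) (e.symm y) = _ :=
      mfderiv_comp (e.symm y) (by rw [e.right_inv hy]; exact hmd') hmd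
    have h2 : (e.symm ∘ e) =ᶠ[𝓝 (e.symm y)] id := by
      filter_upwards [e.open_source.mem_nhds (e.map_target hy)] with z hz using e.left_inv hz
    rw [h2.mfderiv_eq, mfderiv_id] at h1
    have h3 := congr($h1 w)
    rw [e.right_inv hy] at h3
    exact ⟨_, h3.symm⟩
  ext w
  obtain ⟨v, rfl⟩ := hsurj w
  exact congr($hAB v)

end Differential

/-! ### The dual norm: semicontinuity, measurability and almost everywhere identities. -/

section CovectorNorm

variable {n : ℕ} {M : Type*} [EMetricSpace M]
  [ChartedSpace (EuclideanSpace ℝ (Fin n)) M]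
  [RiemannianBundle (fun x : M => TangentSpace (𝓡 n) x)]

theorem covectorNorm_zero {x : M} : covectorNorm (0 : TangentSpace (𝓡 n) x →L[ℝ] ℝ) = 0 := by
  simp [covectorNorm]

theorem covectorNorm_add_le {x : M} (l l' : TangentSpace (𝓡 n) x →L[ℝ] ℝ) :
    covectorNorm (l + l') ≤ covectorNorm l + covectorNorm l' := by
  refine iSup₂_le fun v hv => ?_
  calc ENNReal.ofReal |(l + l') v| ≤ ENNReal.ofReal (|l v| + |l' v|) :=
        ENNReal.ofReal_le_ofReal (abs_add_le _ _)
    _ ≤ ENNReal.ofReal |l v| + ENNReal.ofReal |l' v| := ENNReal.ofReal_add_le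
    _ ≤ _ := add_le_add
        (le_iSup₂ (f := fun (v : TangentSpace (𝓡 n) x) (_ : ‖v‖ ≤ 1) => ENNReal.ofReal |l v|) v hv)
        (le_iSup₂ (f := fun (v : TangentSpace (𝓡 n) x) (_ : ‖v‖ ≤ 1) => ENNReal.ofReal |l' v|) v hv)

theorem covectorNorm_smul_le {x : M} (c : ℝ) (l : TangentSpace (𝓡 n) x →L[ℝ] ℝ) :
    covectorNorm (c • l) ≤ ENNReal.ofReal |c| * covectorNorm l := by
  refine iSup₂_le fun v hv => ?_
  rw [smul_apply, smul_eq_mul, abs_mul, ENNReal.ofReal_mul (abs_nonneg c)]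
  gcongr
  exact le_iSup₂ (f := fun (v : TangentSpace (𝓡 n) x) (_ : ‖v‖ ≤ 1) => ENNReal.ofReal |l v|) v hv

variable [IsManifold (𝓡 n) ∞ M]
  [IsContinuousRiemannianBundle (EuclideanSpace ℝ (Fin n))
    (fun x : M => TangentSpace (𝓡 n) x)] {D : Set M} {f : M → ℝ}

/-- The dual norm of `df` is lower semicontinuous. A vector on which `df` exceeds `a` is carried to
nearby points by the trivialization: the value of `df` varies continuously and the length grows by a
factor close to 1. This makes the energy density measurable. -/
theorem isOpen_lt_covectorNorm_differential (hD : IsOpen D)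
    (hf : ContMDiffOn (𝓡 n) 𝓘(ℝ, ℝ) ∞ f D) (a : ℝ≥0∞) :
    IsOpen {x | x ∈ D ∧ a < covectorNorm (differential n f x)} := by
  rw [isOpen_iff_mem_nhds]
  rintro x ⟨hxD, hx⟩
  obtain ⟨v, hx⟩ := lt_iSup_iff.1 hx
  obtain ⟨hv, hx⟩ := lt_iSup_iff.1 hx
  set e := chartAt (EuclideanSpace ℝ (Fin n)) x
  have he : e ∈ IsManifold.maximalAtlas (𝓡 n) ∞ M := IsManifold.chart_mem_maximalAtlas x
  set T := trivializationAt (EuclideanSpace ℝ (Fin n)) (fun x : M => TangentSpace (𝓡 n) x) x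
  set w : EuclideanSpace ℝ (Fin n) := T.continuousLinearMapAt ℝ x v
  have hxs : x ∈ e.source := mem_chart_source _ x
  have hsymm : ∀ y ∈ e.source, T.symmL ℝ y w = mfderiv (𝓡 n) (𝓡 n) e.symm (e y) w := by
    intro y hy
    have h := TangentBundle.symmL_trivializationAt (I := 𝓡 n) hy
    rw [ModelWithCorners.range_eq_univ, mfderivWithin_univ] at h
    exact congr($h w)
  have hval : ∀ y ∈ e.source ∩ D, differential n f y (T.symmL ℝ y w) =
      fderiv ℝ (fun z => f (e.symm z)) (e y) w := by
    intro y hy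
    have h := differential_mfderiv_symm (f := f) he (e.map_source hy.1)
      (by rw [e.left_inv hy.1]; exact mdifferentiableAt_of_contMDiffOn hD hf hy.2) w
    rw [e.left_inv hy.1] at h
    exact (congrArg (differential n f y) (hsymm y hy.1)).trans h
  have hxv : T.symmL ℝ x w = v :=
    T.symmL_continuousLinearMapAt (FiberBundle.mem_baseSet_trivializationAt' x) v
  have hcont : ContinuousAt (fun y => fderiv ℝ (fun z => f (e.symm z)) (e y) w) x := by
    have h1 : e x ∈ chartDomain D e := ⟨e.map_source hxs, by rwa [mem_preimage, e.left_inv hxs]⟩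
    have h2 := ((((contDiffOn_comp_symm_of_mem_maximalAtlas he hf).continuousOn_fderiv_of_isOpen
      (isOpen_chartDomain hD e) (by simp)).clm_apply
        (continuousOn_const (c := w))).continuousAt ((isOpen_chartDomain hD e).mem_nhds h1))
    exact h2.comp (f := e) (e.continuousAt hxs)
  -- The strict inequality leaves room to divide by some `r > 1`, which brings the transported
  -- vector back into the unit ball.
  obtain ⟨r, hr1, hr⟩ : ∃ r : ℝ, 1 < r ∧ a < ENNReal.ofReal (|differential n f x v| / r) := by
    have h1 : Tendsto (fun r : ℝ => ENNReal.ofReal (|differential n f x v| / r)) (𝓝[>] 1)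
        (𝓝 (ENNReal.ofReal (|differential n f x v| / 1))) :=
      (ENNReal.tendsto_ofReal (tendsto_const_nhds.div tendsto_id one_ne_zero)).mono_left
        nhdsWithin_le_nhds
    rw [div_one] at h1
    exact ((eventually_mem_nhdsWithin).and (h1.eventually_const_lt hx)).exists
  have hr0 : 0 < r := zero_lt_one.trans hr1
  have hev : ∀ᶠ y in 𝓝 x,
      a < ENNReal.ofReal (|fderiv ℝ (fun z => f (e.symm z)) (e y) w| / r) := by
    have h1 := (ENNReal.continuous_ofReal.continuousAt).comp (x := x) ((hcont.abs).div_const r)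
    refine h1.eventually_const_lt ?_
    rw [← hxv, hval x ⟨hxs, hxD⟩] at hr
    exact hr
  filter_upwards [hev, hD.mem_nhds hxD, e.open_source.mem_nhds hxs,
    eventually_norm_symmL_trivializationAt_comp_self_lt (EuclideanSpace ℝ (Fin n))
      (fun x : M => TangentSpace (𝓡 n) x) x hr1] with y hy hyD hys hyr
  refine ⟨hyD, hy.trans_le ?_⟩
  have hn : ‖T.symmL ℝ y w‖ ≤ r :=
    (ContinuousLinearMap.le_of_opNorm_le _ hyr.le v).trans (by nlinarith)
  have hn' : ‖r⁻¹ • T.symmL ℝ y w‖ ≤ 1 := by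
    rw [norm_smul, norm_inv, Real.norm_of_nonneg hr0.le, inv_mul_le_iff₀ hr0, mul_one]
    exact hn
  refine le_trans (le_of_eq ?_) (le_iSup₂ (f := fun (v : TangentSpace (𝓡 n) y) (_ : ‖v‖ ≤ 1) =>
    ENNReal.ofReal |differential n f y v|) (r⁻¹ • T.symmL ℝ y w) hn')
  rw [map_smul, hval y ⟨hys, hyD⟩, smul_eq_mul, abs_mul, abs_inv, abs_of_pos hr0, div_eq_inv_mul]

variable [MeasurableSpace M] [BorelSpace M]

theorem aemeasurable_covectorNorm_differential (hD : IsOpen D)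
    (hf : ContMDiffOn (𝓡 n) 𝓘(ℝ, ℝ) ∞ f D) {μ : Measure M} :
    AEMeasurable (fun x => covectorNorm (differential n f x)) (μ.restrict D) := by
  rw [← aemeasurable_indicator_iff hD.measurableSet]
  refine (measurable_of_Ioi fun a => ?_).aemeasurable
  have h : D.indicator (fun x => covectorNorm (differential n f x)) ⁻¹' Ioi a =
      {x | x ∈ D ∧ a < covectorNorm (differential n f x)} := by
    ext x
    by_cases hx : x ∈ D <;> simp [hx]
  rw [h]
  exact (isOpen_lt_covectorNorm_differential hD hf a).measurableSet

variable [SecondCountableTopology M] [IsRiemannianManifold (𝓡 n) M]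

/-- A weak differential of a smooth function is almost everywhere its classical differential. -/
theorem IsWeakDifferential.ae_eq_differential {θ : ∀ x : M, TangentSpace (𝓡 n) x →L[ℝ] ℝ}
    (h : IsWeakDifferential D f θ) (hD : IsOpen D) (hf : ContMDiffOn (𝓡 n) 𝓘(ℝ, ℝ) ∞ f D) :
    ∀ᵐ x ∂(riemannianVolume n : Measure M).restrict D, θ x = differential n f x := by
  refine ae_restrict_riemannianVolume_of_chart hD fun x _ => ?_
  have he := IsManifold.chart_mem_maximalAtlas (I := 𝓡 n) (n := ∞) x
  filter_upwards [ae_all_iff.2 fun i =>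
    h.ae_covecCoord_eq hD (isWeakDifferential_differential hD hf) he i] with y hy hyD
  exact eq_of_covecCoord_eq he hyD.1 fun i => hy i hyD

theorem ae_differential_eq_zero_of_eq_zero (hD : IsOpen D)
    (hf : ContMDiffOn (𝓡 n) 𝓘(ℝ, ℝ) ∞ f D) :
    ∀ᵐ x ∂(riemannianVolume n : Measure M).restrict D, f x = 0 → differential n f x = 0 := by
  refine ae_restrict_riemannianVolume_of_chart hD fun x _ => ?_
  have he := IsManifold.chart_mem_maximalAtlas (I := 𝓡 n) (n := ∞) x
  filter_upwards [ae_fderiv_eq_zero_of_eq_zero (μ := volume) (isOpen_chartDomain hD _)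
    ((contDiffOn_comp_symm_of_mem_maximalAtlas he hf).differentiableOn (by simp))] with y hy hyD h0
  refine eq_of_covecCoord_eq (θ' := fun _ => 0) he hyD.1 fun i => ?_
  rw [covecCoord_differential he hyD.1 (mdifferentiableAt_of_contMDiffOn hD hf hyD.2),
    hy hyD h0]
  simp [covecCoord]

end CovectorNorm

/-! ### The cutoff profile. -/

section Residue

/-- A smooth function that is the identity near `0` and vanishes outside `(-2, 2)`. -/
def residue (t : ℝ) : ℝ := t * (1 - Real.smoothTransition (t ^ 2 - 1))

theorem contDiff_residue : ContDiff ℝ ∞ residue := by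
  unfold residue
  exact contDiff_id.mul (contDiff_const.sub
    (Real.smoothTransition.contDiff.comp ((contDiff_id.pow 2).sub contDiff_const)))

theorem residue_of_abs_le_one {t : ℝ} (ht : |t| ≤ 1) : residue t = t := by
  have h : t ^ 2 - 1 ≤ 0 := by have := (sq_le_one_iff_abs_le_one t).2 ht; linarith
  simp [residue, Real.smoothTransition.zero_of_nonpos h]

theorem residue_of_two_le_sq {t : ℝ} (ht : 2 ≤ t ^ 2) : residue t = 0 := by
  simp [residue, Real.smoothTransition.one_of_one_le (show 1 ≤ t ^ 2 - 1 by linarith)]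

theorem abs_residue_le (t : ℝ) : |residue t| ≤ |t| := by
  have h0 := Real.smoothTransition.nonneg (t ^ 2 - 1)
  have h1 := Real.smoothTransition.le_one (t ^ 2 - 1)
  rw [residue, abs_mul, abs_of_nonneg (by linarith : 0 ≤ 1 - Real.smoothTransition (t ^ 2 - 1))]
  exact mul_le_of_le_one_right (abs_nonneg t) (by linarith)

theorem residue_of_two_le_abs {t : ℝ} (ht : 2 ≤ |t|) : residue t = 0 :=
  residue_of_two_le_sq (by rw [← sq_abs]; nlinarith)

theorem deriv_residue_of_two_le_abs {t : ℝ} (ht : 2 ≤ |t|) : deriv residue t = 0 := by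
  have h : residue =ᶠ[𝓝 t] fun _ => 0 := by
    have h2 : 2 < t ^ 2 := by rw [← sq_abs]; nlinarith
    filter_upwards [(continuous_pow 2).continuousAt.eventually (lt_mem_nhds h2)] with s hs
    exact residue_of_two_le_sq hs.le
  rw [h.deriv_eq, deriv_const]

/-- The normalization `1 ≤ C` lets `C ^ 2` serve also for the zeroth order term of the energy, where
the factor is 1. -/
theorem exists_abs_deriv_residue_le : ∃ C : ℝ≥0, 1 ≤ C ∧ ∀ t, |deriv residue t| ≤ C := by
  have hc : Continuous (deriv residue) := contDiff_residue.continuous_deriv (by simp)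
  have hs : HasCompactSupport (deriv residue) :=
    HasCompactSupport.intro (isCompact_closedBall (0 : ℝ) 2) fun t ht =>
      deriv_residue_of_two_le_abs (by simpa using (not_le.1 (mt mem_closedBall.2 ht)).le)
  obtain ⟨C, hC⟩ := hc.bounded_above_of_compact_support hs
  exact ⟨max 1 C.toNNReal, le_max_left _ _, fun t => (hC t).trans
    ((Real.le_coe_toNNReal C).trans (NNReal.coe_le_coe.2 (le_max_right _ _)))⟩

end Residue

/-! ### Truncation near the zero set. -/

section Approximation

variable {n : ℕ} {M : Type*}

section Smooth

variable [TopologicalSpace M] [ChartedSpace (EuclideanSpace ℝ (Fin n)) M]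
  {D : Set M} {f : M → ℝ}

theorem differential_comp {F : ℝ → ℝ} {x : M} (hF : DifferentiableAt ℝ F (f x))
    (hf : MDifferentiableAt (𝓡 n) 𝓘(ℝ, ℝ) f x) :
    differential n (fun x => F (f x)) x = deriv F (f x) • differential n f x := by
  have h : mfderiv (𝓡 n) 𝓘(ℝ, ℝ) (F ∘ f) x = _ :=
    mfderiv_comp x hF.mdifferentiableAt hf
  rw [mfderiv_eq_fderiv] at h
  ext v
  refine congr($h v).trans ?_
  have h2 : ∀ t, fderiv ℝ F (f x) t = deriv F (f x) * t := fun t => by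
    rw [fderiv_eq_smul_deriv, smul_eq_mul, mul_comm]
  exact h2 (differential n f x v)

theorem ContMDiffOn.real_comp {F : ℝ → ℝ} (hF : ContDiff ℝ ∞ F)
    (hf : ContMDiffOn (𝓡 n) 𝓘(ℝ, ℝ) ∞ f D) :
    ContMDiffOn (𝓡 n) 𝓘(ℝ, ℝ) ∞ (fun x => F (f x)) D :=
  hF.contMDiff.comp_contMDiffOn hf

/-- The part of `f` that is removed by truncating it at height `ε`. -/
def truncationError (ε : ℝ) (f : M → ℝ) (x : M) : ℝ := ε * residue (f x / ε)

theorem contDiff_mul_residue_div (ε : ℝ) : ContDiff ℝ ∞ fun s => ε * residue (s / ε) :=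
  contDiff_const.mul (contDiff_residue.comp (contDiff_id.div_const ε))

theorem deriv_mul_residue_div {ε : ℝ} (hε : 0 < ε) (s : ℝ) :
    deriv (fun s => ε * residue (s / ε)) s = deriv residue (s / ε) := by
  have h := ((contDiff_residue.differentiable (by simp) (s / ε)).hasDerivAt.comp s
    ((hasDerivAt_id s).div_const ε)).const_mul ε
  refine h.deriv.trans ?_
  field_simp

theorem contMDiffOn_truncationError (hf : ContMDiffOn (𝓡 n) 𝓘(ℝ, ℝ) ∞ f D) (ε : ℝ) :
    ContMDiffOn (𝓡 n) 𝓘(ℝ, ℝ) ∞ (truncationError ε f) D :=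
  ContMDiffOn.real_comp (F := fun s => ε * residue (s / ε)) (contDiff_mul_residue_div ε) hf

theorem differential_truncationError {ε : ℝ} (hε : 0 < ε) {x : M}
    (hf : MDifferentiableAt (𝓡 n) 𝓘(ℝ, ℝ) f x) :
    differential n (truncationError ε f) x = deriv residue (f x / ε) • differential n f x := by
  rw [← deriv_mul_residue_div hε]
  exact differential_comp ((contDiff_mul_residue_div ε).differentiable (by simp) _) hf

theorem abs_truncationError_le {ε : ℝ} (hε : 0 < ε) (f : M → ℝ) (x : M) :
    |truncationError ε f x| ≤ |f x| := by
  rw [truncationError, abs_mul, abs_of_pos hε]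
  have h := abs_residue_le (f x / ε)
  rw [abs_div, abs_of_pos hε, le_div_iff₀ hε] at h
  linarith

/-- The truncated function vanishes wherever `|f| < ε`, so its support lies in `{|f| ≥ ε}` inside
the closure of `D`. Continuity up to the boundary makes this set closed in `M`, and the zero
boundary values keep it off the frontier. -/
theorem sub_truncationError_mem_Fcpt (hD : IsOpen D) (hf : ContMDiffOn (𝓡 n) 𝓘(ℝ, ℝ) ∞ f D)
    (hc : ContinuousOn f (closure D)) (h0 : ∀ x ∈ frontier D, f x = 0) {ε : ℝ} (hε : 0 < ε) :
    f - truncationError ε f ∈ Fcpt n D := by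
  refine ⟨hf.sub (contMDiffOn_truncationError hf ε), ?_⟩
  have hK : IsClosed (closure D ∩ f ⁻¹' {s | ε ≤ |s|}) :=
    hc.preimage_isClosed_of_isClosed isClosed_closure (isClosed_le continuous_const continuous_abs)
  have hsub : Function.support (f - truncationError ε f) ∩ D ⊆
      closure D ∩ f ⁻¹' {s | ε ≤ |s|} := by
    rintro x ⟨hx, hxD⟩
    refine ⟨subset_closure hxD, ?_⟩
    by_contra hlt
    have hlt : |f x| < ε := not_le.1 hlt
    refine hx ?_
    have h1 : |f x / ε| ≤ 1 := by
      rw [abs_div, abs_of_pos hε, div_le_one hε]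
      exact hlt.le
    rw [Pi.sub_apply, truncationError, residue_of_abs_le_one h1, mul_div_cancel₀ _ hε.ne', sub_self]
  intro x hx
  obtain ⟨hx1, hx2⟩ := closure_minimal hsub hK hx
  by_contra hxD
  have hz := h0 x (by rw [hD.frontier_eq]; exact ⟨hx1, hxD⟩)
  have hx2 : ε ≤ |f x| := hx2
  rw [hz, abs_zero] at hx2
  linarith

end Smooth

variable [EMetricSpace M] [SecondCountableTopology M]
  [MeasurableSpace M] [BorelSpace M]
  [ChartedSpace (EuclideanSpace ℝ (Fin n)) M] [IsManifold (𝓡 n) ∞ M]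
  [RiemannianBundle (fun x : M => TangentSpace (𝓡 n) x)]
  [IsContinuousRiemannianBundle (EuclideanSpace ℝ (Fin n))
    (fun x : M => TangentSpace (𝓡 n) x)]
  [IsRiemannianManifold (𝓡 n) M] {D : Set M} {f : M → ℝ}

theorem lintegral_covectorNorm_differential_lt_top (hD : IsOpen D)
    (hf : ContMDiffOn (𝓡 n) 𝓘(ℝ, ℝ) ∞ f D) (hW : f ∈ sobolevSpace n D) :
    ∫⁻ x in D, covectorNorm (differential n f x) ^ 2 ∂(riemannianVolume n) < ⊤ := by
  obtain ⟨-, θ, hθ, hfin⟩ := hW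
  rwa [lintegral_congr_ae (g := fun x => covectorNorm (θ x) ^ 2)
    ((hθ.ae_eq_differential hD hf).mono fun x hx => by simp only [hx])]

theorem lintegral_sq_lt_top {μ : Measure M} (hf : MemLp f 2 μ) :
    ∫⁻ x, ENNReal.ofReal (f x ^ 2) ∂μ < ⊤ :=
  hf.integrable_sq.lintegral_lt_top

/-- Both `residue` and its derivative vanish at `f / ε` once `|f| ≥ 2ε`. Elsewhere the error is at
most `|f|`, and its differential is `df` times a factor bounded by `C`. -/
theorem energy_truncationError_le (hD : IsOpen D) (hf : ContMDiffOn (𝓡 n) 𝓘(ℝ, ℝ) ∞ f D)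
    {C : ℝ≥0} (hC1 : 1 ≤ C) (hC : ∀ t, |deriv residue t| ≤ C) {ε : ℝ} (hε : 0 < ε) :
    energy D (truncationError ε f) (differential n (truncationError ε f)) ≤
      (C : ℝ≥0∞) ^ 2 * ∫⁻ x in D ∩ f ⁻¹' ball 0 (2 * ε),
        (ENNReal.ofReal (f x ^ 2) + covectorNorm (differential n f x) ^ 2)
          ∂(riemannianVolume n) := by
  have hA : IsOpen (D ∩ f ⁻¹' ball 0 (2 * ε)) := hf.continuousOn.isOpen_inter_preimage hD isOpen_ball
  rw [← lintegral_const_mul' _ _ (by simp), energy]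
  set A := D ∩ f ⁻¹' ball 0 (2 * ε) with hAdef
  have hle : ∀ x ∈ D, ENNReal.ofReal (truncationError ε f x ^ 2) +
      covectorNorm (differential n (truncationError ε f) x) ^ 2 ≤
      A.indicator (fun x => (C : ℝ≥0∞) ^ 2 * (ENNReal.ofReal (f x ^ 2) +
        covectorNorm (differential n f x) ^ 2)) x := by
    intro x hx
    rw [differential_truncationError hε (mdifferentiableAt_of_contMDiffOn hD hf hx)]
    by_cases hxA : x ∈ A
    · rw [indicator_of_mem hxA, mul_add]
      refine add_le_add ?_ ?_
      · refine le_trans (ENNReal.ofReal_le_ofReal (sq_le_sq.2 (abs_truncationError_le hε f x))) ?_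
        exact le_mul_of_one_le_left zero_le (one_le_pow₀ (by exact_mod_cast hC1))
      · rw [← mul_pow]
        gcongr
        refine (covectorNorm_smul_le _ _).trans ?_
        gcongr
        rw [← ENNReal.ofReal_coe_nnreal]
        exact ENNReal.ofReal_le_ofReal (hC _)
    · have h2 : 2 ≤ |f x / ε| := by
        rw [abs_div, abs_of_pos hε, le_div_iff₀ hε]
        by_contra hlt
        exact hxA ⟨hx, by simpa using hlt⟩
      simp [truncationError, residue_of_two_le_abs h2, deriv_residue_of_two_le_abs h2,
        covectorNorm_zero]
  refine (setLIntegral_mono' hD.measurableSet hle).trans ?_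
  rw [lintegral_indicator hA.measurableSet, Measure.restrict_restrict hA.measurableSet,
    inter_eq_self_of_subset_left (inter_subset_left)]

theorem exists_energy_truncationError_lt (hD : IsOpen D)
    (hf : ContMDiffOn (𝓡 n) 𝓘(ℝ, ℝ) ∞ f D) (hW : f ∈ sobolevSpace n D) {δ : ℝ≥0∞} (hδ : 0 < δ) :
    ∃ ε : ℝ, 0 < ε ∧
      energy D (truncationError ε f) (differential n (truncationError ε f)) < δ := by
  obtain ⟨C, hC1, hC⟩ := exists_abs_deriv_residue_le
  set h : M → ℝ≥0∞ := fun x => ENNReal.ofReal (f x ^ 2) + covectorNorm (differential n f x) ^ 2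
  -- The energy of `f` is regarded as a measure, finite on `D`, so that continuity from above
  -- applies to the sets `A k`, which decrease to `{f = 0}`.
  set ν := ((riemannianVolume n : Measure M).restrict D).withDensity h
  set A : ℕ → Set M := fun k => D ∩ f ⁻¹' ball 0 (2 * (1 / ((k : ℝ) + 1)))
  have hAo : ∀ k, IsOpen (A k) := fun k => hf.continuousOn.isOpen_inter_preimage hD isOpen_ball
  have hνA : ∀ s ⊆ D, MeasurableSet s → ν s = ∫⁻ x in s, h x ∂(riemannianVolume n) := by
    intro s hs hsm
    rw [withDensity_apply _ hsm, Measure.restrict_restrict hsm, inter_eq_self_of_subset_left hs]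
  have hfin : ν D < ⊤ := by
    rw [hνA D subset_rfl hD.measurableSet, lintegral_add_left']
    · exact ENNReal.add_lt_top.2 ⟨lintegral_sq_lt_top hW.1,
        lintegral_covectorNorm_differential_lt_top hD hf hW⟩
    · exact ENNReal.measurable_ofReal.comp_aemeasurable
        ((hf.continuousOn.aemeasurable hD.measurableSet).pow_const 2)
  have hlim : Tendsto (fun k => ν (A k)) atTop (𝓝 (ν (⋂ k, A k))) := by
    refine tendsto_measure_iInter_atTop (fun k => (hAo k).measurableSet.nullMeasurableSet) ?_
      ⟨0, ((measure_mono inter_subset_left).trans_lt hfin).ne⟩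
    intro k l hkl x hx
    refine ⟨hx.1, ball_subset_ball ?_ hx.2⟩
    gcongr
  have hzero : ν (⋂ k, A k) = 0 := by
    have hsub : ∀ x ∈ ⋂ k, A k, x ∈ D ∧ f x = 0 := by
      intro x hx
      rw [mem_iInter] at hx
      refine ⟨(hx 0).1, ?_⟩
      have h1 : Tendsto (fun k : ℕ => 2 * (1 / ((k : ℝ) + 1))) atTop (𝓝 (2 * 0)) :=
        tendsto_one_div_add_atTop_nhds_zero_nat.const_mul 2
      rw [mul_zero] at h1
      have h2 : |f x| ≤ 0 := ge_of_tendsto' h1 fun k => by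
        have := (hx k).2
        rw [mem_preimage, mem_ball_zero_iff, Real.norm_eq_abs] at this
        exact this.le
      exact abs_nonpos_iff.1 h2
    have hm : MeasurableSet (⋂ k, A k) := MeasurableSet.iInter fun k => (hAo k).measurableSet
    rw [hνA _ (fun x hx => (hsub x hx).1) hm]
    have hae := ae_restrict_of_ae_restrict_of_subset (s := ⋂ k, A k) (fun x hx => (hsub x hx).1)
      (ae_differential_eq_zero_of_eq_zero hD hf)
    rw [lintegral_congr_ae (g := fun _ => 0), lintegral_zero]
    filter_upwards [hae, ae_restrict_mem hm] with x hx hxm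
    have h0 := (hsub x hxm).2
    simp [h, h0, hx h0, covectorNorm_zero]
  rw [hzero] at hlim
  have hlim2 : Tendsto (fun k => (C : ℝ≥0∞) ^ 2 * ν (A k)) atTop (𝓝 ((C : ℝ≥0∞) ^ 2 * 0)) :=
    ENNReal.Tendsto.const_mul hlim (Or.inr (by simp))
  rw [mul_zero] at hlim2
  obtain ⟨k, hk⟩ := (hlim2.eventually_lt_const hδ).exists
  have hpos : (0 : ℝ) < 1 / ((k : ℝ) + 1) := by positivity
  refine ⟨_, hpos, (energy_truncationError_le hD hf hC1 hC hpos).trans_lt ?_⟩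
  rwa [← hνA _ inter_subset_left (hAo k).measurableSet]

theorem sub_truncationError_mem_sobolevSpace (hD : IsOpen D)
    (hf : ContMDiffOn (𝓡 n) 𝓘(ℝ, ℝ) ∞ f D) (hW : f ∈ sobolevSpace n D) {ε : ℝ} (hε : 0 < ε) :
    f - truncationError ε f ∈ sobolevSpace n D := by
  obtain ⟨C, hC1, hC⟩ := exists_abs_deriv_residue_le
  have hsm := contMDiffOn_truncationError hf ε
  have hmem : MemLp (truncationError ε f) 2 ((riemannianVolume n : Measure M).restrict D) :=
    hW.1.mono (hsm.continuousOn.aestronglyMeasurable hD.measurableSet)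
      (Eventually.of_forall fun x => abs_truncationError_le hε f x)
  refine ⟨hW.1.sub hmem, _, isWeakDifferential_differential hD (hf.sub hsm), ?_⟩
  have hle : ∀ x ∈ D, covectorNorm (differential n (f - truncationError ε f) x) ^ 2 ≤
      (1 + C : ℝ≥0∞) ^ 2 * covectorNorm (differential n f x) ^ 2 := by
    intro x hx
    have hfx := mdifferentiableAt_of_contMDiffOn hD hf hx
    have hF : ContDiff ℝ ∞ fun s : ℝ => s - ε * residue (s / ε) :=
      contDiff_id.sub (contDiff_mul_residue_div ε)
    have h1 : differential n (f - truncationError ε f) x = _ :=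
      differential_comp (F := fun s : ℝ => s - ε * residue (s / ε))
        (hF.differentiable (by simp) _) hfx
    rw [h1, ← mul_pow]
    gcongr
    refine (covectorNorm_smul_le _ _).trans ?_
    gcongr
    rw [deriv_fun_sub differentiableAt_fun_id
      ((contDiff_mul_residue_div ε).differentiable (by simp) _), deriv_mul_residue_div hε]
    refine (ENNReal.ofReal_le_ofReal ((abs_sub _ _).trans (add_le_add_right (hC _) _))).trans ?_
    simp [ENNReal.ofReal_add]
  refine (setLIntegral_mono' hD.measurableSet hle).trans_lt ?_
  rw [lintegral_const_mul' _ _ (by simp)]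
  exact ENNReal.mul_lt_top (by simp) (lintegral_covectorNorm_differential_lt_top hD hf hW)

/-- This is (a + b)² ≤ 2a² + 2b² under the integral. Nothing is known about measurability of the
norm of `θ`; smoothness of `w` makes the second summand measurable, which is enough to split the
lower integral. -/
theorem energy_add_le (hD : IsOpen D) {u w : M → ℝ}
    (θ : ∀ x : M, TangentSpace (𝓡 n) x →L[ℝ] ℝ) (hw : ContMDiffOn (𝓡 n) 𝓘(ℝ, ℝ) ∞ w D) :
    energy D (u + w) (fun x => θ x + differential n w x) ≤
      2 * energy D u θ + 2 * energy D w (differential n w) := by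
  rw [energy, energy, energy, ← lintegral_const_mul' _ _ (by simp),
    ← lintegral_const_mul' _ _ (by simp), ← lintegral_add_right']
  · refine lintegral_mono fun x => ?_
    have h1 : ENNReal.ofReal ((u + w) x ^ 2) ≤
        2 * ENNReal.ofReal (u x ^ 2) + 2 * ENNReal.ofReal (w x ^ 2) := by
      rw [← ENNReal.ofReal_ofNat, ← ENNReal.ofReal_mul (by simp), ← ENNReal.ofReal_mul (by simp),
        ← ENNReal.ofReal_add (by positivity) (by positivity)]
      refine ENNReal.ofReal_le_ofReal ?_
      simp only [Pi.add_apply]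
      nlinarith [sq_nonneg (u x - w x)]
    have h2 : covectorNorm (θ x + differential n w x) ^ 2 ≤
        2 * covectorNorm (θ x) ^ 2 + 2 * covectorNorm (differential n w x) ^ 2 := by
      refine (pow_le_pow_left₀ zero_le (covectorNorm_add_le _ _) 2).trans ?_
      have h3 := ENNReal.rpow_add_le_mul_rpow_add_rpow (covectorNorm (θ x))
        (covectorNorm (differential n w x)) (p := 2) (by norm_num)
      norm_num at h3
      rwa [mul_add] at h3
    calc _ ≤ _ := add_le_add h1 h2
      _ = _ := by ring
  · refine AEMeasurable.const_mul (AEMeasurable.add ?_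
      ((aemeasurable_covectorNorm_differential hD hw).pow_const 2)) 2
    exact ENNReal.measurable_ofReal.comp_aemeasurable
      ((hw.continuousOn.aemeasurable hD.measurableSet).pow_const 2)

theorem rpow_half_lt_iff {a b : ℝ≥0∞} : a ^ (1 / 2 : ℝ) < b ↔ a < b ^ 2 := by
  rw [one_div, ENNReal.rpow_inv_lt_iff (by norm_num)]
  norm_num

/-- If smooth functions `f` vanishing on the boundary approximate `u`, then so do smooth functions
with support in `D`. -/
theorem exists_mem_Fcpt_sobolevNorm_sub_lt (hD : IsOpen D) {u : M → ℝ}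
    (hf : f ∈ FZero n D) (hW : f ∈ sobolevSpace n D) {ε : ℝ≥0∞} (hε : 0 < ε)
    (h : sobolevNorm n D (u - f) < ε / 2) :
    ∃ g ∈ Fcpt n D ∩ sobolevSpace n D, sobolevNorm n D (u - g) < ε := by
  obtain ⟨hsm, hc, h0⟩ := hf
  have hε2 : 0 < ε / 2 := ENNReal.half_pos hε.ne'
  obtain ⟨θ, h⟩ := iInf_lt_iff.1 h
  obtain ⟨hθ, h⟩ := iInf_lt_iff.1 h
  -- With both energies below `(ε / 2) ^ 2`, the factors 2 of `energy_add_le` add up to exactly `ε ^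
  -- 2`.
  obtain ⟨r, hr, hE⟩ := exists_energy_truncationError_lt hD hsm hW (δ := (ε / 2) ^ 2)
    (ENNReal.pow_pos hε2 2)
  refine ⟨f - truncationError r f, ⟨sub_truncationError_mem_Fcpt hD hsm hc h0 hr,
    sub_truncationError_mem_sobolevSpace hD hsm hW hr⟩, ?_⟩
  have hw := contMDiffOn_truncationError hsm r
  have hwd := hθ.add (isWeakDifferential_differential hD hw)
  rw [show u - (f - truncationError r f) = u - f + truncationError r f by ring]
  refine (iInf₂_le _ hwd).trans_lt (rpow_half_lt_iff.2 ?_)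
  refine (energy_add_le hD θ hw).trans_lt ?_
  rw [rpow_half_lt_iff] at h
  calc 2 * energy D (u - f) θ +
        2 * energy D (truncationError r f) (differential n (truncationError r f))
      < 2 * (ε / 2) ^ 2 + 2 * (ε / 2) ^ 2 :=
        ENNReal.add_lt_add (ENNReal.mul_right_strictMono (by simp) (by simp) h)
          (ENNReal.mul_right_strictMono (by simp) (by simp) hE)
    _ = (ε / 2 + ε / 2) ^ 2 := by ring
    _ = ε ^ 2 := by rw [ENNReal.add_halves]

end Approximation

/-! ### Pointwise vanishing on the boundary. -/

section BoundaryValues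

variable {n : ℕ} {M : Type*}

theorem dist_dropCoord_le (i : Fin n) (y z : EuclideanSpace ℝ (Fin n)) :
    dist (dropCoord i y) (dropCoord i z) ≤ dist y z := by
  rw [EuclideanSpace.dist_eq, EuclideanSpace.dist_eq]
  refine Real.sqrt_le_sqrt ?_
  have h := Finset.sum_subtype (F := inferInstance) (p := (· ≠ i)) (Finset.univ.filter (· ≠ i)) (by simp)
    (fun j => dist (y j) (z j) ^ 2)
  refine le_trans (le_of_eq ?_) (Finset.sum_le_sum_of_subset_of_nonneg
    (Finset.filter_subset (· ≠ i) Finset.univ) fun _ _ _ => by positivity)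
  exact h.symm

theorem lipschitzWith_dropCoord (i : Fin n) : LipschitzWith 1 (dropCoord i) :=
  LipschitzWith.of_dist_le_mul fun y z => by simpa using dist_dropCoord_le i y z

/-- The point over `x` with vertical coordinate `r`. -/
def insertCoord (i : Fin n) (x : EuclideanSpace ℝ {j : Fin n // j ≠ i}) (r : ℝ) :
    EuclideanSpace ℝ (Fin n) :=
  WithLp.toLp 2 fun j => if h : j = i then r else x ⟨j, h⟩

theorem dropCoord_insertCoord (i : Fin n) (x : EuclideanSpace ℝ {j : Fin n // j ≠ i}) (r : ℝ) :
    dropCoord i (insertCoord i x r) = x := by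
  ext j
  simp [dropCoord, insertCoord, j.2]

theorem insertCoord_self (i : Fin n) (x : EuclideanSpace ℝ {j : Fin n // j ≠ i}) (r : ℝ) :
    insertCoord i x r i = r := by
  simp [insertCoord]

theorem insertCoord_dropCoord (i : Fin n) (y : EuclideanSpace ℝ (Fin n)) :
    insertCoord i (dropCoord i y) (y i) = y := by
  ext j
  by_cases h : j = i
  · subst h; simp [insertCoord]
  · simp [insertCoord, dropCoord, h]

theorem continuousOn_insertCoord (i : Fin n) {V : Set (EuclideanSpace ℝ {j : Fin n // j ≠ i})}
    {g : EuclideanSpace ℝ {j : Fin n // j ≠ i} → ℝ} (hg : ContinuousOn g V) :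
    ContinuousOn (fun x => insertCoord i x (g x)) V := by
  refine (PiLp.continuous_toLp 2 _).comp_continuousOn (continuousOn_pi.2 fun j => ?_)
  by_cases h : j = i
  · simpa [h] using hg
  · simp only [h, dite_false]
    fun_prop

variable [EMetricSpace M] [MeasurableSpace M] [BorelSpace M]
  [ChartedSpace (EuclideanSpace ℝ (Fin n)) M] [IsManifold (𝓡 n) ∞ M]
  [RiemannianBundle (fun x : M => TangentSpace (𝓡 n) x)]
  [IsContinuousRiemannianBundle (EuclideanSpace ℝ (Fin n))
    (fun x : M => TangentSpace (𝓡 n) x)]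
  [IsRiemannianManifold (𝓡 n) M] {D : Set M} {f : M → ℝ}

/-- Near a point at which the boundary is Lipschitz, the boundary has positive hypersurface
measure. -/
theorem IsLipschitzBoundaryAt.measure_ne_zero {p : M} (hp : p ∈ frontier D)
    (h : IsLipschitzBoundaryAt n D p) {O : Set M} (hO : O ∈ 𝓝 p) :
    (μHE[n - 1] : Measure M) (O ∩ frontier D) ≠ 0 := by
  intro hnull
  obtain ⟨e, he, hpe, i, V, -, ⟨hV, -⟩, u, v, L, hu, -, -, hΓ⟩ := h
  obtain ⟨K, s, hs, hK⟩ := exists_lipschitzOnWith_of_mem_maximalAtlas he hpe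
  have hpΓ : e p ∈ e '' (frontier D ∩ e.source) := mem_image_of_mem e ⟨hp, hpe⟩
  rw [hΓ] at hpΓ
  obtain ⟨O', hO'sub, hO', hpO'⟩ := mem_nhds_iff.1 (inter_mem hO hs)
  -- The base points whose graph points lie in the given neighbourhood. `T` is open and nonempty,
  -- and the Lipschitz map `dropCoord i ∘ e` sends the boundary piece onto a set containing it; a
  -- null piece would make `T` null.
  set T : Set (EuclideanSpace ℝ {j : Fin n // j ≠ i}) :=
    V ∩ (fun x => insertCoord i x (u x)) ⁻¹' (e.target ∩ e.symm ⁻¹' O') with hT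
  have hTo : IsOpen T := (continuousOn_insertCoord i hu.continuousOn).isOpen_inter_preimage hV
    (e.isOpen_inter_preimage_symm hO')
  have hTne : T.Nonempty := by
    refine ⟨dropCoord i (e p), hpΓ.1, ?_⟩
    rw [mem_preimage, ← hpΓ.2, insertCoord_dropCoord]
    exact ⟨e.map_source hpe, by rwa [mem_preimage, e.left_inv hpe]⟩
  have hTsub : T ⊆ (dropCoord i ∘ e) '' (O ∩ frontier D ∩ s) := by
    rintro x ⟨hxV, hxt, hxO⟩
    have hxΓ : insertCoord i x (u x) ∈ e '' (frontier D ∩ e.source) := by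
      rw [hΓ]
      simp only [mem_ofPred_eq, dropCoord_insertCoord, insertCoord_self]
      exact ⟨hxV, trivial⟩
    obtain ⟨q, ⟨hqD, hqe⟩, hq⟩ := hxΓ
    change e.symm (insertCoord i x (u x)) ∈ O' at hxO
    rw [← hq, e.left_inv hqe] at hxO
    refine ⟨q, ⟨⟨(hO'sub hxO).1, hqD⟩, (hO'sub hxO).2⟩, ?_⟩
    rw [Function.comp, hq, dropCoord_insertCoord]
  have hlip : LipschitzOnWith (1 * K) (dropCoord i ∘ e) (O ∩ frontier D ∩ s) :=
    (lipschitzWith_dropCoord i).comp_lipschitzOnWith (hK.mono inter_subset_right)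
  have hT0 := measure_mono_null hTsub
    (euclideanHausdorffMeasure_image_eq_zero hlip (measure_mono_null inter_subset_left hnull))
  have hrank : Module.finrank ℝ (EuclideanSpace ℝ {j : Fin n // j ≠ i}) = n - 1 := by
    rw [finrank_euclideanSpace, Fintype.card_subtype_compl]
    simp
  rw [← hrank, InnerProductSpace.euclideanHausdorffMeasure_eq_volume] at hT0
  exact (hTo.measure_pos volume hTne).ne' hT0

variable [SecondCountableTopology M]

theorem euclideanHausdorffMeasure_support_eq_zero_of_mem_FL2 (hf : f ∈ FL2 n D) :
    (μHE[n - 1] : Measure M) ({x | f x ≠ 0} ∩ frontier D) = 0 := by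
  obtain ⟨-, hc, h0⟩ := hf
  have hm : MeasurableSet (frontier D) := isClosed_frontier.measurableSet
  rw [eLpNorm_eq_zero_iff
    ((hc.mono frontier_subset_closure).aestronglyMeasurable hm) (by simp)] at h0
  rw [← Measure.restrict_apply' hm]
  exact h0

/-- If `f p ≠ 0`, continuity makes `f` nonzero on a whole boundary neighbourhood of `p`, which has
positive measure. -/
theorem eq_zero_of_isLipschitzBoundaryAt (hf : f ∈ FL2 n D) {p : M} (hp : p ∈ frontier D)
    (h : IsLipschitzBoundaryAt n D p) : f p = 0 := by
  by_contra hne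
  have hO : {x | x ∈ closure D → f x ≠ 0} ∈ 𝓝 p :=
    mem_nhdsWithin_iff_eventually.1
      ((hf.2.1 p (frontier_subset_closure hp)).eventually_ne hne)
  refine h.measure_ne_zero hp hO (measure_mono_null ?_ (euclideanHausdorffMeasure_support_eq_zero_of_mem_FL2 hf))
  exact fun x hx => ⟨hx.1 (frontier_subset_closure hx.2), hx.2⟩

/-- The vertex of a cone is an accumulation point of it. -/
theorem neBot_nhdsWithin_of_isDiffeoIntoCone {F G : Type*} [NormedAddCommGroup F]
    [NormedSpace ℝ F] [NormedAddCommGroup G] [NormedSpace ℝ G] {p : M} {S : Set M}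
    {lam : M → F × G} {linv : F × G → M} {A : Set F} {B : Set G}
    (h : IsDiffeoIntoCone n p S lam linv A B) (hAB : (A ×ˢ B).Nonempty)
    (h0 : (0 : F × G) ∉ A ×ˢ B) : (𝓝[S \ {p}] p).NeBot := by
  obtain ⟨z, hz⟩ := hAB
  have hz0 : z ≠ 0 := fun hz0 => h0 (hz0 ▸ hz)
  -- The approaching points come from a ray of the cone, pulled back by `linv`.
  have hcone : Tendsto (fun t : ℝ => t • z) (𝓝[>] 0) (𝓝[cone A B] 0) := by
    refine tendsto_nhdsWithin_iff.2 ⟨?_, ?_⟩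
    · have : Tendsto (fun t : ℝ => t • z) (𝓝 0) (𝓝 ((0 : ℝ) • z)) :=
        (continuous_id.smul continuous_const).tendsto 0
      rw [zero_smul] at this
      exact this.mono_left nhdsWithin_le_nhds
    · filter_upwards [self_mem_nhdsWithin] with t ht
      exact ⟨t, (mem_Ioi.1 ht).le, z.1, hz.1, z.2, hz.2, rfl⟩
  have himg : ∀ᶠ t : ℝ in 𝓝[>] 0, t • z ∈ lam '' S := hcone h.image_mem_nhds
  have hp0 : linv 0 = p := by rw [← h.map_vertex, h.leftInv h.mem]
  have hlim : Tendsto (fun t : ℝ => linv (t • z)) (𝓝[>] 0) (𝓝[S \ {p}] p) := by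
    refine tendsto_nhdsWithin_iff.2 ⟨?_, ?_⟩
    · have h1 : ContinuousWithinAt linv (lam '' S) 0 :=
        h.continuousOn_inv 0 ⟨p, h.mem, h.map_vertex⟩
      rw [ContinuousWithinAt, hp0] at h1
      exact h1.comp (tendsto_nhdsWithin_iff.2 ⟨hcone.mono_right nhdsWithin_le_nhds, himg⟩)
    · filter_upwards [himg, self_mem_nhdsWithin] with t ⟨q, hqS, hq⟩ ht
      rw [← hq, h.leftInv hqS]
      refine ⟨hqS, fun hqp => ?_⟩
      rw [mem_singleton_iff.1 hqp, h.map_vertex] at hq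
      exact (smul_ne_zero (ne_of_gt (mem_Ioi.1 ht)) hz0) hq.symm
  exact hlim.neBot

theorem eq_zero_on_frontier_of_isGluingMap {N : Type*} [TopologicalSpace N]
    [ChartedSpace (EuclideanSpace ℝ (Fin n)) N] {φ : N → M} {Ω : Set N} {P : Set M}
    (hφ : IsGluingMap n φ Ω D P) (hf : f ∈ FL2 n D) {p : M} (hp : p ∈ frontier D) : f p = 0 := by
  by_cases hpP : p ∈ P
  swap
  · exact eq_zero_of_isLipschitzBoundaryAt hf hp (hφ.boundary_lipschitz p ⟨hp, hpP⟩)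
  -- For `n ≤ 1` the unit sphere of ℝ⁰ is empty and the cone gives no nearby boundary points. In
  -- that case `n - 1 = 0` and single points have positive measure.
  rcases Nat.lt_or_ge 1 n with hn | hn
  · obtain ⟨k, hk, -, m, A, f₁, g₁, hA, -, hS, U, lam, -, linv, hU, hpU, -, hcone, -⟩ :=
      hφ.glued p hpP
    have hk' : 0 < n - 1 - k := by rcases hk with ⟨rfl, -⟩ | ⟨-, hk, -⟩ <;> omega
    have : Nonempty (Fin (n - 1 - k)) := ⟨⟨0, hk'⟩⟩
    have hAne : A.Nonempty := by
      rw [← hφ.boundary] at hp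
      obtain ⟨q, hq, hqp⟩ := hp
      rw [← hA.image_eq]
      exact ⟨f₁ q, q, ⟨hq, hqp⟩, rfl⟩
    have hSne : (sphere (0 : EuclideanSpace ℝ (Fin (n - 1 - k))) 1).Nonempty :=
      NormedSpace.sphere_nonempty.2 zero_le_one
    have hne := neBot_nhdsWithin_of_isDiffeoIntoCone hcone (hAne.prod hSne) hS.1
    have h1 : Tendsto f (𝓝[(U ∩ frontier D) \ {p}] p) (𝓝 (f p)) :=
      (hf.2.1 p (frontier_subset_closure hp)).mono_left
        (nhdsWithin_mono p fun x hx => frontier_subset_closure hx.1.2)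
    have h2 : ∀ᶠ x in 𝓝[(U ∩ frontier D) \ {p}] p, f x = 0 := by
      -- `P` is finite, so the boundary points near `p` other than `p` are Lipschitz points, where
      -- `f` is already known to vanish.
      have hfin : (P \ {p})ᶜ ∈ 𝓝 p :=
        (hφ.finite_glued.subset sdiff_subset).isClosed.isOpen_compl.mem_nhds fun h => h.2 rfl
      filter_upwards [self_mem_nhdsWithin, mem_nhdsWithin_of_mem_nhds hfin] with x hx hxP
      exact eq_zero_of_isLipschitzBoundaryAt hf hx.1.2
        (hφ.boundary_lipschitz x ⟨hx.1.2, fun h => hxP ⟨h, hx.2⟩⟩)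
    exact tendsto_nhds_unique h1 (tendsto_const_nhds.congr' (h2.mono fun x hx => hx.symm))
  · have h := euclideanHausdorffMeasure_support_eq_zero_of_mem_FL2 hf
    rw [Nat.sub_eq_zero_of_le hn, Measure.euclideanHausdorffMeasure_zero] at h
    by_contra hne
    have h1 := measure_mono_null (singleton_subset_iff.2 (show p ∈ {x | f x ≠ 0} ∩ frontier D from ⟨hne, hp⟩)) h
    simp at h1

end BoundaryValues

/-! ### Inclusions between the closures. -/

section Closures

variable {n : ℕ} {M : Type*}

section Smooth

variable [TopologicalSpace M] [ChartedSpace (EuclideanSpace ℝ (Fin n)) M] {D : Set M} {g : M → ℝ}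

/-- The closure of the support lies in `D`, so every point outside `D` has a neighbourhood on which
the extension by zero vanishes. -/
theorem contMDiff_indicator_of_mem_Fcpt (hD : IsOpen D) (hg : g ∈ Fcpt n D) :
    ContMDiff (𝓡 n) 𝓘(ℝ, ℝ) ∞ (D.indicator g) := by
  intro x
  by_cases hx : x ∈ D
  · refine ((hg.1 x hx).contMDiffAt (hD.mem_nhds hx)).congr_of_eventuallyEq ?_
    filter_upwards [hD.mem_nhds hx] with y hy using indicator_of_mem hy g
  · have h : D.indicator g =ᶠ[𝓝 x] fun _ => 0 := by
      filter_upwards [isClosed_closure.isOpen_compl.mem_nhds (fun h => hx (hg.2 h))] with y hy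
      by_contra hne
      exact hy (subset_closure ⟨(indicator_apply_ne_zero.1 hne).2, (indicator_apply_ne_zero.1 hne).1⟩)
    exact contMDiffAt_const.congr_of_eventuallyEq h

theorem indicator_mem_FOne [IsManifold (𝓡 n) ∞ M] (hD : IsOpen D) (hg : g ∈ Fcpt n D) :
    D.indicator g ∈ FOne n D := by
  have hsm := contMDiff_indicator_of_mem_Fcpt hD hg
  refine ⟨hsm.contMDiffOn, ⟨hsm.continuous.continuousOn,
    (hsm.mdifferentiable (by simp)).mdifferentiableOn, differential n (D.indicator g),
    fun _ _ _ => rfl, fun e he i => ?_⟩, fun x hx => ?_⟩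
  · exact (continuousOn_covecCoord_differential isOpen_univ he hsm.contMDiffOn i).mono
      fun y hy => ⟨hy.1, mem_univ _⟩
  · rw [hD.frontier_eq] at hx
    exact indicator_of_notMem hx.2 g

end Smooth

variable [EMetricSpace M] [MeasurableSpace M] [BorelSpace M]
  [ChartedSpace (EuclideanSpace ℝ (Fin n)) M]
  [RiemannianBundle (fun x : M => TangentSpace (𝓡 n) x)] {D : Set M}

theorem sobolevNorm_congr [IsManifold (𝓡 n) ∞ M] (hD : IsOpen D) {u u' : M → ℝ} (h : EqOn u u' D) :
    sobolevNorm n D u = sobolevNorm n D u' := by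
  refine iInf_congr fun θ => iInf_congr_Prop
    ⟨fun hθ => hθ.congr hD h, fun hθ => hθ.congr hD h.symm⟩ fun _ => ?_
  have he : energy D u θ = energy D u' θ :=
    setLIntegral_congr_fun hD.measurableSet fun x hx => by simp only [h hx]
  rw [he]

theorem mem_sobolevSpace_congr [IsManifold (𝓡 n) ∞ M] (hD : IsOpen D) {u u' : M → ℝ} (h : EqOn u u' D)
    (hu : u ∈ sobolevSpace n D) : u' ∈ sobolevSpace n D := by
  obtain ⟨hm, θ, hθ, hfin⟩ := hu
  exact ⟨(memLp_congr_ae ((ae_restrict_mem hD.measurableSet).mono fun x hx => h hx)).1 hm,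
    θ, hθ.congr hD h, hfin⟩

theorem sobolevClosure_mono {S T : Set (M → ℝ)} (h : S ∩ sobolevSpace n D ⊆ T) :
    sobolevClosure n D S ⊆ sobolevClosure n D T := by
  rintro u ⟨hu, hS⟩
  refine ⟨hu, fun ε hε => ?_⟩
  obtain ⟨f, hf, hlt⟩ := hS ε hε
  exact ⟨f, ⟨h hf, hf.2⟩, hlt⟩

/-- Members of `Fcpt` have arbitrary values outside `D`, so they need not lie in `FOne`. Replacing
them by their extension by zero changes neither membership in the Sobolev space nor the norm. -/
theorem sobolevClosure_Fcpt_subset_FOne [IsManifold (𝓡 n) ∞ M] (hD : IsOpen D) :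
    sobolevClosure n D (Fcpt n D) ⊆ sobolevClosure n D (FOne n D) := by
  rintro u ⟨hu, hS⟩
  refine ⟨hu, fun ε hε => ?_⟩
  obtain ⟨g, ⟨hg, hgW⟩, hlt⟩ := hS ε hε
  have heq : EqOn g (D.indicator g) D := fun x hx => (indicator_of_mem hx g).symm
  refine ⟨D.indicator g, ⟨indicator_mem_FOne hD hg, mem_sobolevSpace_congr hD heq hgW⟩, ?_⟩
  rwa [sobolevNorm_congr hD (u' := u - g) fun x hx => by simp [indicator_of_mem hx]]

theorem FOne_subset_FZero : FOne n D ⊆ FZero n D :=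
  fun _ hf => ⟨hf.1, hf.2.1.1, hf.2.2⟩

theorem FZero_subset_FL2 : FZero n D ⊆ FL2 n D := by
  refine fun f hf => ⟨hf.1, hf.2.1, ?_⟩
  rw [eLpNorm_congr_ae (g := 0) ((ae_restrict_mem isClosed_frontier.measurableSet).mono
    fun x hx => hf.2.2 x hx), eLpNorm_zero]

variable [SecondCountableTopology M] [IsManifold (𝓡 n) ∞ M]
  [IsContinuousRiemannianBundle (EuclideanSpace ℝ (Fin n))
    (fun x : M => TangentSpace (𝓡 n) x)]
  [IsRiemannianManifold (𝓡 n) M]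

theorem sobolevClosure_FZero_subset_Fcpt (hD : IsOpen D) :
    sobolevClosure n D (FZero n D) ⊆ sobolevClosure n D (Fcpt n D) := by
  rintro u ⟨hu, hS⟩
  refine ⟨hu, fun ε hε => ?_⟩
  obtain ⟨f, ⟨hf, hfW⟩, hlt⟩ := hS (ε / 2) (ENNReal.half_pos hε.ne')
  exact exists_mem_Fcpt_sobolevNorm_sub_lt hD hf hfW hε hlt

end Closures

end QuasiLipschitz

end

theorem corollary3p2 {n : ℕ} {M : Type u} [EMetricSpace M] [SecondCountableTopology M]
    [MeasurableSpace M] [BorelSpace M]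
    [ChartedSpace (EuclideanSpace ℝ (Fin n)) M] [IsManifold (𝓡 n) ∞ M]
    [RiemannianBundle (fun x : M => TangentSpace (𝓡 n) x)]
    [IsContMDiffRiemannianBundle (𝓡 n) ∞ (EuclideanSpace ℝ (Fin n))
      (fun x : M => TangentSpace (𝓡 n) x)]
    [IsRiemannianManifold (𝓡 n) M]
    (D : Set M) (hD : QuasiLipschitz.IsQuasiLipschitzDomain.{u, v} n D) :
    QuasiLipschitz.H n D = QuasiLipschitz.sobolevSpaceZero n D ∧
    QuasiLipschitz.sobolevClosure n D (QuasiLipschitz.Fcpt n D) = QuasiLipschitz.H n D ∧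
    QuasiLipschitz.sobolevClosure n D (QuasiLipschitz.FOne n D) = QuasiLipschitz.H n D ∧
    QuasiLipschitz.sobolevClosure n D
      (QuasiLipschitz.FZero n D ∩ QuasiLipschitz.sobolevSpace n D) = QuasiLipschitz.H n D ∧
    QuasiLipschitz.sobolevClosure n D
      (QuasiLipschitz.FL2 n D ∩ QuasiLipschitz.sobolevSpace n D) = QuasiLipschitz.H n D := by
  have := QuasiLipschitz.isContinuousRiemannianBundle_of_isContMDiff (n := n) (M := M)
  obtain ⟨hDo, -, N, _, _, _, _, _, φ, Ω, P, hφ⟩ := hD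
  -- The gluing map enters only here; everything after this holds on any open set on which this
  -- inclusion is valid.
  have hFL2 : QuasiLipschitz.FL2 n D ⊆ QuasiLipschitz.FZero n D := fun f hf =>
    ⟨hf.1, hf.2.1, fun x hx => QuasiLipschitz.eq_zero_on_frontier_of_isGluingMap hφ hf hx⟩
  have h1 : QuasiLipschitz.H n D ⊆
      QuasiLipschitz.sobolevClosure n D (QuasiLipschitz.FZero n D) :=
    QuasiLipschitz.sobolevClosure_mono (inter_subset_left.trans hFL2)
  have h2 := QuasiLipschitz.sobolevClosure_FZero_subset_Fcpt (n := n) hDo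
  have h3 := QuasiLipschitz.sobolevClosure_Fcpt_subset_FOne (n := n) hDo
  have h4 : QuasiLipschitz.sobolevClosure n D (QuasiLipschitz.FOne n D) ⊆
      QuasiLipschitz.sobolevClosure n D
        (QuasiLipschitz.FZero n D ∩ QuasiLipschitz.sobolevSpace n D) :=
    QuasiLipschitz.sobolevClosure_mono
      (inter_subset_inter_left _ QuasiLipschitz.FOne_subset_FZero)
  have h5 : QuasiLipschitz.sobolevClosure n D
        (QuasiLipschitz.FZero n D ∩ QuasiLipschitz.sobolevSpace n D) ⊆
      QuasiLipschitz.sobolevClosure n D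
        (QuasiLipschitz.FL2 n D ∩ QuasiLipschitz.sobolevSpace n D) :=
    QuasiLipschitz.sobolevClosure_mono (inter_subset_left.trans
      (inter_subset_inter_left _ QuasiLipschitz.FZero_subset_FL2))
  have h6 : QuasiLipschitz.sobolevClosure n D
        (QuasiLipschitz.FL2 n D ∩ QuasiLipschitz.sobolevSpace n D) ⊆ QuasiLipschitz.H n D :=
    QuasiLipschitz.sobolevClosure_mono (inter_subset_left.trans inter_subset_left)
  -- `hH` and `hF` close a cycle of inclusions through all the closures, so every equality follows
  -- by antisymmetry.
  have hH := h1.trans h2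
  have hF := h3.trans (h4.trans (h5.trans h6))
  exact ⟨hH.antisymm hF, hF.antisymm hH, (h4.trans (h5.trans h6)).antisymm (hH.trans h3),
    (h5.trans h6).antisymm (hH.trans (h3.trans h4)),
    h6.antisymm (hH.trans (h3.trans (h4.trans h5)))⟩
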